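/- **Definitions.** A *multicategory* has objects and arrows $f : \langle X_1,\dots,X_n\rangle \to X$ ($n\ge 0$), with identities and associative, unital composition $f(g_1,\dots,g_n)$, whose domain is the concatenation of the domains of the $g_i$. A *cartesian multicategory* is a multicategory $\mathcal M$ with an fp-structure: let $\mathbf N/\mathrm{obj}\,\mathcal M$ be the category whose objects are the finite sequences $\alpha:\{1,\dots,n\}\to \mathrm{obj}\,\mathcal M$ and whose morphisms $p:\alpha\to\beta$ are the mappings $p$ of index sets with $\beta p=\alpha$; for each object $X$ the assignment $\alpha\mapsto\mathcal M(\alpha;X)$ is extended to a functor $\mathbf N/\mathrm{obj}\,\mathcal M\to\mathbf{Set}$, such that $$f(p_1f_1,\dots,p_nf_n)=(p_1+\cdots+p_n)\,f(f_1,\dots,f_n),\qquad (pf)(f_1,\dots,f_m)=p'\,\bigl(f(f_{p1},\dots,f_{pn})\bigr),$$ where $p_1+\cdots+p_n$ is the blockwise sum of mappings and $p'$ maps the $i$-th block identically onto the $p(i)$-th block. An *fp-functor* is a functor of multicategories commuting with these actions. Let $\mathbf{fpMlt}$ be the category of cartesian multicategories and fp-functors. A *preadditive category* is a category enriched in commutative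 monoids (no negatives required); with additive functors they form the category $\mathbf{cMonCat}$. For a category $\mathcal C$, the *discrete cocone multicategory* $\mathcal C_\blacktriangleright$ has the objects of $\mathcal C$ and $\mathcal C_\blacktriangleright(X_1,\dots,X_n;X)=\mathcal C(X_1;X)\times\cdots\times\mathcal C(X_n;X)$, with composition induced by that of $\mathcal C$. If $\mathcal C$ is preadditive, $\mathcal C_\blacktriangleright$ carries the fp-structure in which $p\langle f_1,\dots,f_n\rangle$ has $j$-th term $\sum_{p(i)=j}f_i$; this gives a functor $(-)_\blacktriangleright:\mathbf{cMonCat}\to\mathbf{fpMlt}$. Let $\mathbf{fpCat}_\blacktriangleright\subset\mathbf{fpMlt}$ be the full subcategory of those cartesian multicategories whose underlying multicategory is isomorphic to $\mathcal C_\blacktriangleright$ for some category $\mathcal C$. For a cartesian multicategory $\mathcal M$, let $\mathrm{cMon}(\mathcal M)$ be the category of commutative monoids in $\mathcal M$ (objects $X$ with $m_2:\langle X,X\rangle\to X$ and $m_0:\langle\rangle\to X$ that are associative, unital and invariant under the exchange), with the unary arrows preserving $m_2$ and $m_0$ as morphisms. It is preadditive: $f+g$ is the contraction of $m_2(f,g)$,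 and $0$ is the weakening of $m_0$. This gives a functor $\mathrm{cMon}(-):\mathbf{fpMlt}\to\mathbf{cMonCat}$. **Statement.** The functor $(-)_\blacktriangleright$ is an equivalence of categories $\mathbf{cMonCat}\simeq\mathbf{fpCat}_\blacktriangleright$, and the full subcategory $\mathbf{fpCat}_\blacktriangleright$ is coreflective in $\mathbf{fpMlt}$: the inclusion $\mathbf{fpCat}_\blacktriangleright\hookrightarrow\mathbf{fpMlt}$ has a right adjoint, and such a right adjoint is given by the functor $\mathcal M\mapsto \mathrm{cMon}(\mathcal M)_\blacktriangleright$. -/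

import Mathlib

open CategoryTheory

universe v u w

/-- A finite sequence `⟨X₁, …, Xₙ⟩` of elements of `O`, that is a mapping `{1, …, n} → O`. -/
structure Ctx (O : Type u) where
  len : ℕ
  fam : Fin len → O

namespace Ctx

/-- The sequence `⟨X, …, X⟩` of length `n`. -/
abbrev replicate {O : Type u} (n : ℕ) (X : O) : Ctx O := ⟨n, fun _ => X⟩

/-- The concatenation of a finite sequence of sequences. -/
abbrev concat {O : Type u} {n : ℕ} (Δ : Fin n → Ctx O) : Ctx O :=
  ⟨∑ i, (Δ i).len, fun s => (Δ (finSigmaFinEquiv.symm s).1).fam (finSigmaFinEquiv.symm s).2⟩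

theorem concat_fam {O : Type u} {n : ℕ} (Δ : Fin n → Ctx O) (i : Fin n) (x : Fin (Δ i).len) :
    (concat Δ).fam (finSigmaFinEquiv ⟨i, x⟩) = (Δ i).fam x :=
  congrArg (fun z : Σ i, Fin (Δ i).len => (Δ z.1).fam z.2)
    (finSigmaFinEquiv.symm_apply_apply (⟨i, x⟩ : Σ i, Fin (Δ i).len))

/-- The image of a sequence under a mapping. -/
abbrev map {O : Type u} {P : Type w} (F : O → P) (Γ : Ctx O) : Ctx P := ⟨Γ.len, fun i => F (Γ.fam i)⟩

/-- A morphism `Γ ⟶ Δ` in the comma category `N / O`: a mapping of the index sets that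
commutes with the mappings to `O`. -/
@[ext]
structure Hom {O : Type u} (Γ Δ : Ctx O) where
  toFun : Fin Γ.len → Fin Δ.len
  w : ∀ i, Δ.fam (toFun i) = Γ.fam i

/-- The comma category `N / O`, where `N` is the full subcategory of `Set` on the `{1, …, n}`. -/
instance {O : Type u} : Category (Ctx O) where
  Hom := Hom
  id Γ := ⟨fun i => i, fun _ => rfl⟩
  comp p q := ⟨fun i => q.toFun (p.toFun i), fun i => (q.w _).trans (p.w i)⟩

/-- The morphism of `N / P` induced by one of `N / O` and a mapping `O → P`. -/
def mapHom {O : Type u} {P : Type w} (F : O → P) {Γ Δ : Ctx O} (p : Γ ⟶ Δ) :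
    Γ.map F ⟶ Δ.map F :=
  ⟨p.toFun, fun i => congrArg F (p.w i)⟩

/-- The sequence `⟨X_{p 1}, …, X_{p n}⟩`. -/
abbrev pull {O : Type u} {n : ℕ} (Γ : Ctx O) (p : Fin n → Fin Γ.len) : Ctx O :=
  ⟨n, fun i => Γ.fam (p i)⟩

/-- A mapping `p`, seen as a morphism `⟨X_{p 1}, …, X_{p n}⟩ ⟶ ⟨X₁, …, Xₘ⟩`. -/
def pullHom {O : Type u} {n : ℕ} (Γ : Ctx O) (p : Fin n → Fin Γ.len) : Γ.pull p ⟶ Γ :=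
  ⟨p, fun _ => rfl⟩

/-- The sum `p₁ + ⋯ + pₙ` of morphisms `pᵢ : Δᵢ ⟶ Δ'ᵢ`. -/
def sumHom {O : Type u} {n : ℕ} {Δ Δ' : Fin n → Ctx O} (p : ∀ i, Δ i ⟶ Δ' i) :
    concat Δ ⟶ concat Δ' where
  toFun s := finSigmaFinEquiv
    ⟨(finSigmaFinEquiv.symm s).1, (p _).toFun (finSigmaFinEquiv.symm s).2⟩
  w _ := (concat_fam Δ' _ _).trans ((p _).w _)

/-- The morphism which maps the `i`-th block of `Δ_{p 1}, …, Δ_{p n}` identically onto the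
`p i`-th block of `Δ₁, …, Δₘ`. -/
def blockHom {O : Type u} {n m : ℕ} (p : Fin n → Fin m) (Δ : Fin m → Ctx O) :
    concat (fun i => Δ (p i)) ⟶ concat Δ where
  toFun s := finSigmaFinEquiv ⟨p (finSigmaFinEquiv.symm s).1, (finSigmaFinEquiv.symm s).2⟩
  w _ := concat_fam Δ _ _

end Ctx

/-- A (plain) multicategory. The two sides of each law have domains which are equal as sequences,
but not definitionally so; hence the laws are stated as equalities of arrows together with
their domains. -/
structure Mlt where
  /-- objects -/
  Obj : Type u
  /-- the arrows `⟨X₁, …, Xₙ⟩ → X` -/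
  Hom : Ctx Obj → Obj → Type v
  /-- identities -/
  id : ∀ X, Hom (Ctx.replicate 1 X) X
  /-- the composite `f(g₁, …, gₙ)` -/
  comp : ∀ {Γ : Ctx Obj} {X : Obj}, Hom Γ X → ∀ {Δ : Fin Γ.len → Ctx Obj},
    (∀ i, Hom (Δ i) (Γ.fam i)) → Hom (Ctx.concat Δ) X
  id_comp : ∀ {Γ : Ctx Obj} {X : Obj} (f : Hom Γ X),
    (⟨_, comp (id X) (Δ := fun _ => Γ) (fun _ => f)⟩ : Σ Θ, Hom Θ X) = ⟨_, f⟩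
  comp_id : ∀ {Γ : Ctx Obj} {X : Obj} (f : Hom Γ X),
    (⟨_, comp f (fun i => id (Γ.fam i))⟩ : Σ Θ, Hom Θ X) = ⟨_, f⟩
  assoc : ∀ {Γ : Ctx Obj} {X : Obj} (f : Hom Γ X) {Δ : Fin Γ.len → Ctx Obj}
    (g : ∀ i, Hom (Δ i) (Γ.fam i)) {Θ : ∀ i, Fin (Δ i).len → Ctx Obj}
    (h : ∀ i j, Hom (Θ i j) ((Δ i).fam j)),
    (⟨_, comp (comp f g) (Δ := fun s => Θ (finSigmaFinEquiv.symm s).1 (finSigmaFinEquiv.symm s).2)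
      (fun s => h (finSigmaFinEquiv.symm s).1 (finSigmaFinEquiv.symm s).2)⟩ : Σ Ξ, Hom Ξ X) =
    ⟨_, comp f (fun i => comp (g i) (h i))⟩

namespace Mlt

/-- A (multi)functor between multicategories. -/
@[ext]
structure Functor (M : Mlt.{v, u}) (N : Mlt.{v, u}) where
  obj : M.Obj → N.Obj
  map : ∀ {Γ : Ctx M.Obj} {X : M.Obj}, M.Hom Γ X → N.Hom (Γ.map obj) (obj X)
  map_id : ∀ X, map (M.id X) = N.id (obj X)
  map_comp : ∀ {Γ : Ctx M.Obj} {X : M.Obj} (f : M.Hom Γ X) {Δ : Fin Γ.len → Ctx M.Obj}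
    (g : ∀ i, M.Hom (Δ i) (Γ.fam i)),
    map (M.comp f g) =
      N.comp (map f) (Δ := fun i => (Δ i).map obj) (fun i => map (g i))

/-- The category of multicategories and functors. -/
instance : Category Mlt.{v, u} where
  Hom := Functor
  id M := ⟨fun X => X, fun f => f, fun _ => rfl, fun _ _ _ => rfl⟩
  comp F G := ⟨fun X => G.obj (F.obj X), fun f => G.map (F.map f),
    fun X => (congrArg G.map (F.map_id X)).trans (G.map_id _),
    fun f _ g => (congrArg G.map (F.map_comp f g)).trans (G.map_comp _ _)⟩

end Mlt

/-- A cartesian multicategory: a multicategory with an fp-structure, that is a functorial action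
of the mappings in the comma category `N / Obj` on the arrows with a given codomain, which is
compatible with composition. -/
structure FpMlt extends Mlt.{v, u} where
  /-- the action of `p : Γ ⟶ Δ` on arrows with domain `Γ` -/
  act : ∀ {Γ Δ : Ctx Obj} {X : Obj}, (Γ ⟶ Δ) → Hom Γ X → Hom Δ X
  act_id : ∀ {Γ : Ctx Obj} {X : Obj} (f : Hom Γ X), act (𝟙 Γ) f = f
  act_act : ∀ {Γ Δ Θ : Ctx Obj} {X : Obj} (p : Γ ⟶ Δ) (q : Δ ⟶ Θ) (f : Hom Γ X),
    act (p ≫ q) f = act q (act p f)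
  /-- `f(p₁ g₁, …, pₙ gₙ) = (p₁ + ⋯ + pₙ)(f(g₁, …, gₙ))` -/
  comp_act : ∀ {Γ : Ctx Obj} {X : Obj} (f : Hom Γ X) {Δ Δ' : Fin Γ.len → Ctx Obj}
    (p : ∀ i, Δ i ⟶ Δ' i) (g : ∀ i, Hom (Δ i) (Γ.fam i)),
    comp f (fun i => act (p i) (g i)) = act (Ctx.sumHom p) (comp f g)
  /-- `(p f)(g₁, …, gₘ) = p' (f(g_{p 1}, …, g_{p n}))` -/
  act_comp : ∀ {Γ : Ctx Obj} {X : Obj} {n : ℕ} (p : Fin n → Fin Γ.len) (f : Hom (Γ.pull p) X)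
    {Δ : Fin Γ.len → Ctx Obj} (g : ∀ j, Hom (Δ j) (Γ.fam j)),
    comp (act (Γ.pullHom p) f) g =
      act (Ctx.blockHom p Δ) (comp f (Δ := fun i => Δ (p i)) (fun i => g (p i)))

namespace FpMlt

/-- An fp-functor: a functor of multicategories which commutes with the actions. -/
@[ext]
structure Functor (M N : FpMlt.{v, u}) extends Mlt.Functor M.toMlt N.toMlt where
  map_act : ∀ {Γ Δ : Ctx M.Obj} {X : M.Obj} (p : Γ ⟶ Δ) (f : M.Hom Γ X),
    map (M.act p f) = N.act (Ctx.mapHom obj p) (map f)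

/-- The category of cartesian multicategories and fp-functors. -/
instance : Category FpMlt.{v, u} where
  Hom := Functor
  id M := ⟨𝟙 M.toMlt, fun _ _ => rfl⟩
  comp {M _ N} F G := ⟨CategoryStruct.comp (obj := Mlt.{v, u}) F.toFunctor G.toFunctor,
    fun p f => (congrArg G.map (F.map_act p f)).trans (G.map_act _ _)⟩

/-- The functor which forgets the fp-structure. -/
def forget : FpMlt.{v, u} ⥤ Mlt.{v, u} where
  obj M := M.toMlt
  map F := Functor.toFunctor F

end FpMlt

namespace Ctx

theorem pos_lt_of {n : ℕ} {k : Fin n → ℕ} (a b : Σ i, Fin (k i))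
    (h : a.1 < b.1 ∨ a.1 = b.1 ∧ (a.2 : ℕ) < b.2) :
    finSigmaFinEquiv a < finSigmaFinEquiv b := by
  have key : ∀ c : Σ i, Fin (k i), (finSigmaFinEquiv c : ℕ) =
      (∑ i ∈ Finset.univ.filter (fun i => i < c.1), k i) + c.2 := by
    intro c
    rw [finSigmaFinEquiv_apply]
    congr 1
    refine Finset.sum_bij (fun i _ => Fin.castLE c.1.2.le i) ?_ ?_ ?_ ?_
    · intro i _
      exact Finset.mem_filter.2 ⟨Finset.mem_univ _, i.2⟩
    · intro i _ j _ hij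
      simpa [Fin.ext_iff] using hij
    · intro j hj
      simp only [Finset.mem_filter, Finset.mem_univ, true_and] at hj
      exact ⟨⟨j, hj⟩, Finset.mem_univ _, rfl⟩
    · intro i _
      rfl
  rw [Fin.lt_def, key, key]
  clear key
  rcases h with h | ⟨h1, h2⟩
  · have h3 : (∑ i ∈ Finset.univ.filter (fun i => i < a.1), k i) + k a.1 ≤
        ∑ i ∈ Finset.univ.filter (fun i => i < b.1), k i := by
      rw [add_comm, ← Finset.sum_insert (by simp)]
      refine Finset.sum_le_sum_of_subset ?_
      intro i hi
      simp only [Finset.mem_insert, Finset.mem_filter, Finset.mem_univ, true_and] at hi ⊢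
      rcases hi with rfl | hi
      · exact h
      · exact hi.trans h
    have := a.2.2
    omega
  · have h3 : (∑ i ∈ Finset.univ.filter (fun i => i < a.1), k i) =
        ∑ i ∈ Finset.univ.filter (fun i => i < b.1), k i := by rw [h1]
    omega

theorem pos_lt {n : ℕ} {k : Fin n → ℕ} (a b : Σ i, Fin (k i)) :
    finSigmaFinEquiv a < finSigmaFinEquiv b ↔ a.1 < b.1 ∨ a.1 = b.1 ∧ (a.2 : ℕ) < b.2 := by
  refine ⟨fun h => ?_, pos_lt_of a b⟩
  by_contra hc
  push Not at hc
  obtain ⟨h1, h2⟩ := hc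
  rcases h1.lt_or_eq with h3 | h3
  · exact absurd (pos_lt_of b a (Or.inl h3)) h.asymm
  · rcases (h2 h3.symm).lt_or_eq with h4 | h4
    · exact absurd (pos_lt_of b a (Or.inr ⟨h3, h4⟩)) h.asymm
    · have : a = b := by
        obtain ⟨i, x⟩ := a
        obtain ⟨j, y⟩ := b
        obtain rfl : j = i := h3
        obtain rfl : y = x := Fin.ext h4
        rfl
      exact absurd h (this ▸ lt_irrefl _)

theorem lt_iff_blk {n : ℕ} {k : Fin n → ℕ} (s t : Fin (∑ i, k i)) :
    s < t ↔ (finSigmaFinEquiv.symm s).1 < (finSigmaFinEquiv.symm t).1 ∨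
      (finSigmaFinEquiv.symm s).1 = (finSigmaFinEquiv.symm t).1 ∧
      ((finSigmaFinEquiv.symm s).2 : ℕ) < (finSigmaFinEquiv.symm t).2 := by
  rw [← pos_lt, Equiv.apply_symm_apply, Equiv.apply_symm_apply]

/-- Position in a twofold concatenation, bracketed to the left. -/
def posL {n : ℕ} {k : Fin n → ℕ} {m : ∀ i, Fin (k i) → ℕ} :
    Fin (∑ s : Fin (∑ i, k i), m (finSigmaFinEquiv.symm s).1 (finSigmaFinEquiv.symm s).2) ≃
      Σ z : (Σ i, Fin (k i)), Fin (m z.1 z.2) :=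
  finSigmaFinEquiv.symm.trans
    (Equiv.sigmaCongrLeft (β := fun z : (Σ i, Fin (k i)) => Fin (m z.1 z.2))
      finSigmaFinEquiv.symm)

/-- Position in a twofold concatenation, bracketed to the right. -/
def posR {n : ℕ} {k : Fin n → ℕ} {m : ∀ i, Fin (k i) → ℕ} :
    Fin (∑ i, ∑ j, m i j) ≃ Σ z : (Σ i, Fin (k i)), Fin (m z.1 z.2) :=
  (finSigmaFinEquiv.symm.trans (Equiv.sigmaCongrRight fun _ => finSigmaFinEquiv.symm)).trans
    (Equiv.sigmaAssoc (fun i j => Fin (m i j))).symm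

theorem posL_lt {n : ℕ} {k : Fin n → ℕ} {m : ∀ i, Fin (k i) → ℕ}
    (s t : Fin (∑ s : Fin (∑ i, k i),
      m (finSigmaFinEquiv.symm s).1 (finSigmaFinEquiv.symm s).2)) :
    s < t ↔ (posL s).1.1 < (posL t).1.1 ∨ (posL s).1.1 = (posL t).1.1 ∧
      (((posL s).1.2 : ℕ) < (posL t).1.2 ∨ ((posL s).1.2 : ℕ) = (posL t).1.2 ∧
        ((posL s).2 : ℕ) < (posL t).2) := by
  have A : s < t ↔ (finSigmaFinEquiv.symm s).1 < (finSigmaFinEquiv.symm t).1 ∨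
    (finSigmaFinEquiv.symm s).1 = (finSigmaFinEquiv.symm t).1 ∧
      ((posL s).2 : ℕ) < (posL t).2 := lt_iff_blk s t
  have B : (finSigmaFinEquiv.symm s).1 < (finSigmaFinEquiv.symm t).1 ↔
    (posL s).1.1 < (posL t).1.1 ∨ (posL s).1.1 = (posL t).1.1 ∧
      ((posL s).1.2 : ℕ) < (posL t).1.2 :=
    lt_iff_blk (finSigmaFinEquiv.symm s).1 (finSigmaFinEquiv.symm t).1
  have E : (finSigmaFinEquiv.symm s).1 = (finSigmaFinEquiv.symm t).1 ↔
    (posL s).1 = (posL t).1 := finSigmaFinEquiv.symm.injective.eq_iff.symm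
  have h1 : (posL s).1.1 = (posL t).1.1 →
      ((posL s).1.2 ≍ (posL t).1.2 ↔ ((posL s).1.2 : ℕ) = (posL t).1.2) := by
    intro h
    exact Fin.heq_ext_iff (by rw [h])
  rw [A, B, E, Sigma.ext_iff]
  generalize posL s = a at h1 ⊢
  generalize posL t = b at h1 ⊢
  by_cases h : a.1.1 = b.1.1
  · rw [h1 h]
    simp only [h, true_and, false_or, lt_irrefl]
  · simp only [h, false_and, or_false]

theorem posR_lt {n : ℕ} {k : Fin n → ℕ} {m : ∀ i, Fin (k i) → ℕ}
    (a b : Σ z : (Σ i, Fin (k i)), Fin (m z.1 z.2)) :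
    posR.symm a < posR.symm b ↔ a.1.1 < b.1.1 ∨ a.1.1 = b.1.1 ∧
      ((a.1.2 : ℕ) < b.1.2 ∨ (a.1.2 : ℕ) = b.1.2 ∧ (a.2 : ℕ) < b.2) := by
  obtain ⟨⟨i, j⟩, x⟩ := a
  obtain ⟨⟨i', j'⟩, x'⟩ := b
  have h : ∀ i j x, posR.symm (⟨⟨i, j⟩, x⟩ : Σ z : (Σ i, Fin (k i)), Fin (m z.1 z.2)) =
    finSigmaFinEquiv ⟨i, finSigmaFinEquiv ⟨j, x⟩⟩ := fun _ _ _ => rfl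
  rw [h, h, pos_lt]
  refine or_congr Iff.rfl (and_congr_right ?_)
  rintro rfl
  refine Fin.lt_def.symm.trans ((pos_lt _ _).trans ?_)
  simp only [Fin.lt_def, Fin.ext_iff]

/-- The two bracketings of a twofold concatenation have the same positions. -/
noncomputable def assocIso {n : ℕ} (k : Fin n → ℕ) (m : ∀ i, Fin (k i) → ℕ) :
    Fin (∑ s : Fin (∑ i, k i), m (finSigmaFinEquiv.symm s).1 (finSigmaFinEquiv.symm s).2) ≃o
      Fin (∑ i, ∑ j, m i j) :=
  StrictMono.orderIsoOfSurjective (fun s => posR.symm (posL s))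
    (fun s t hst => (posR_lt _ _).2 ((posL_lt s t).1 hst))
    (posL.trans posR.symm).surjective

theorem posR_assocIso {n : ℕ} (k : Fin n → ℕ) (m : ∀ i, Fin (k i) → ℕ)
    (s : Fin (∑ s : Fin (∑ i, k i), m (finSigmaFinEquiv.symm s).1 (finSigmaFinEquiv.symm s).2)) :
    posR (assocIso k m s) = posL s :=
  posR.apply_symm_apply (posL s)

/-- The concatenation of `n` one-term sequences has `n` positions. -/
noncomputable def unitIso (n : ℕ) : Fin (∑ _ : Fin n, 1) ≃o Fin n :=
  StrictMono.orderIsoOfSurjective (fun s => (finSigmaFinEquiv.symm s).1)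
    (fun s t hst => by
      rcases (lt_iff_blk s t).1 hst with h | ⟨_, h⟩
      · exact h
      · omega)
    (fun i => ⟨finSigmaFinEquiv ⟨i, 0⟩, congrArg Sigma.fst (finSigmaFinEquiv.symm_apply_apply (⟨i, 0⟩ : Σ _ : Fin n, Fin 1))⟩)

/-- The concatenation of a single sequence of length `n` has `n` positions. -/
noncomputable def singleIso (n : ℕ) : Fin (∑ _ : Fin 1, n) ≃o Fin n :=
  StrictMono.orderIsoOfSurjective (fun s => (finSigmaFinEquiv.symm s).2)
    (fun s t hst => by
      rcases (lt_iff_blk s t).1 hst with h | ⟨_, h⟩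
      · omega
      · exact h)
    (fun i => ⟨finSigmaFinEquiv ⟨0, i⟩, congrArg (fun z : Σ _ : Fin 1, Fin n => z.2)
      (finSigmaFinEquiv.symm_apply_apply (⟨0, i⟩ : Σ _ : Fin 1, Fin n))⟩)

end Ctx

/-- Two sequences of arrows with codomain `X` are equal (together with their domains) when they
are termwise so. -/
theorem cocone_ext {C : Type u} [Category.{v} C] {X : C} {Γ Δ : Ctx C}
    (f : ∀ i, Γ.fam i ⟶ X) (g : ∀ i, Δ.fam i ⟶ X) (e : Fin Γ.len ≃o Fin Δ.len)
    (h : ∀ i, (⟨_, f i⟩ : Σ Y, Y ⟶ X) = ⟨_, g (e i)⟩) :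
    (⟨Γ, f⟩ : Σ Θ : Ctx C, ∀ i, Θ.fam i ⟶ X) = ⟨Δ, g⟩ := by
  obtain ⟨n, Γ⟩ := Γ
  obtain ⟨m, Δ⟩ := Δ
  obtain rfl : n = m := by simpa using Fintype.card_congr e.toEquiv
  obtain rfl : e = OrderIso.refl _ := Subsingleton.elim _ _
  obtain rfl : Γ = Δ := funext fun i => congrArg Sigma.fst (h i)
  obtain rfl : f = g := funext fun i => eq_of_heq (Sigma.ext_iff.1 (h i)).2
  rfl

/-- The discrete cocone multicategory of a category `C`: an arrow `⟨X₁, …, Xₙ⟩ → X` is a sequence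
of arrows `Xᵢ ⟶ X` of `C`. -/
def cocone (C : Type u) [Category.{v} C] : Mlt.{v, u} where
  Obj := C
  Hom Γ X := ∀ i, Γ.fam i ⟶ X
  id X := fun _ => 𝟙 X
  comp f _ g := fun s => g (finSigmaFinEquiv.symm s).1 (finSigmaFinEquiv.symm s).2 ≫
    f (finSigmaFinEquiv.symm s).1
  id_comp {Γ _} f := cocone_ext _ _ (Ctx.singleIso Γ.len) fun _ =>
    congrArg (Sigma.mk _) (Category.comp_id _)
  comp_id {Γ _} f := cocone_ext _ _ (Ctx.unitIso Γ.len) fun _ =>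
    congrArg (Sigma.mk _) (Category.id_comp _)
  assoc {Γ X} f Δ g Θ h := cocone_ext _ _
    (Ctx.assocIso (fun i => (Δ i).len) (fun i j => (Θ i j).len)) fun s => by
    exact (congrArg (fun z : Σ z : (Σ i, Fin (Δ i).len), Fin (Θ z.1 z.2).len =>
      (⟨_, h z.1.1 z.1.2 z.2 ≫ g z.1.1 z.1.2 ≫ f z.1.1⟩ : Σ Y, Y ⟶ X))
      (Ctx.posR_assocIso (fun i => (Δ i).len) (fun i j => (Θ i j).len) s).symm).trans
        (congrArg (Sigma.mk _) (Category.assoc _ _ _).symm)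

/-- An enrichment of a category in commutative monoids (a preadditive structure,
where no negatives are required). -/
class CMonEnriched (C : Type u) [Category.{v} C] where
  addCommMonoid : ∀ X Y : C, AddCommMonoid (X ⟶ Y)
  add_comp : ∀ {X Y Z : C} (f g : X ⟶ Y) (h : Y ⟶ Z), (f + g) ≫ h = f ≫ h + g ≫ h
  comp_add : ∀ {X Y Z : C} (f : X ⟶ Y) (g h : Y ⟶ Z), f ≫ (g + h) = f ≫ g + f ≫ h
  zero_comp : ∀ {X Y Z : C} (h : Y ⟶ Z), (0 : X ⟶ Y) ≫ h = 0
  comp_zero : ∀ {X Y Z : C} (f : X ⟶ Y), f ≫ (0 : Y ⟶ Z) = 0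

attribute [reducible, instance] CMonEnriched.addCommMonoid

/-- A preadditive category, that is a category enriched in commutative monoids. -/
structure CMonCat where
  carrier : Type u
  [cat : Category.{v} carrier]
  [enriched : CMonEnriched carrier]

namespace CMonCat

attribute [instance] CMonCat.cat CMonCat.enriched

/-- An additive functor. -/
@[ext]
structure Functor (C D : CMonCat.{v, u}) extends C.carrier ⥤ D.carrier where
  map_add : ∀ {X Y : C.carrier} (f g : X ⟶ Y), map (f + g) = map f + map g
  map_zero : ∀ X Y : C.carrier, map (0 : X ⟶ Y) = 0

/-- The category of preadditive categories and additive functors. -/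
instance : Category CMonCat.{v, u} where
  Hom := Functor
  id C := ⟨𝟭 C.carrier, fun _ _ => rfl, fun _ _ => rfl⟩
  comp F G := ⟨F.toFunctor ⋙ G.toFunctor,
    fun f g => (congrArg G.map (F.map_add f g)).trans (G.map_add _ _),
    fun X Y => (congrArg G.map (F.map_zero X Y)).trans (G.map_zero _ _)⟩

end CMonCat

namespace CMonEnriched

theorem comp_sum {C : Type u} [Category.{v} C] [CMonEnriched C] {X Y Z : C} {ι : Type*}
    [Fintype ι] (f : X ⟶ Y) (g : ι → (Y ⟶ Z)) : f ≫ ∑ i, g i = ∑ i, f ≫ g i :=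
  map_sum (⟨⟨fun g => f ≫ g, comp_zero f⟩, fun g h => comp_add f g h⟩ : (Y ⟶ Z) →+ (X ⟶ Z)) g _

theorem sum_comp {C : Type u} [Category.{v} C] [CMonEnriched C] {X Y Z : C} {ι : Type*}
    [Fintype ι] (f : ι → (X ⟶ Y)) (g : Y ⟶ Z) : (∑ i, f i) ≫ g = ∑ i, f i ≫ g :=
  map_sum (⟨⟨fun f => f ≫ g, zero_comp g⟩, fun f h => add_comp f h g⟩ : (X ⟶ Y) →+ (X ⟶ Z)) f _

/-- The action of `p` on a sequence `⟨f₁, …, fₙ⟩` of arrows with the same codomain: the `j`-th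
term of the result is the sum of the `fᵢ` with `p i = j`. -/
def act {C : Type u} [Category.{v} C] [CMonEnriched C] {X : C} {Γ Δ : Ctx C} (p : Γ ⟶ Δ)
    (f : ∀ i, Γ.fam i ⟶ X) (j : Fin Δ.len) : Δ.fam j ⟶ X :=
  ∑ i : {i : Fin Γ.len // p.toFun i = j},
    eqToHom ((congrArg Δ.fam i.2).symm.trans (p.w i)) ≫ f i

theorem act_id {C : Type u} [Category.{v} C] [CMonEnriched C] {X : C} {Γ : Ctx C}
    (f : ∀ i, Γ.fam i ⟶ X) : act (𝟙 Γ) f = f := by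
  funext j
  refine (Finset.sum_eq_single ⟨j, rfl⟩ (fun a _ ha => absurd (Subtype.ext a.2) ha)
    (fun h => absurd ?_ h)).trans (Category.id_comp _)
  exact @Finset.mem_univ _ (_) _

theorem act_act {C : Type u} [Category.{v} C] [CMonEnriched C] {X : C} {Γ Δ Θ : Ctx C}
    (p : Γ ⟶ Δ) (q : Δ ⟶ Θ) (f : ∀ i, Γ.fam i ⟶ X) : act (p ≫ q) f = act q (act p f) := by
  funext k
  simp only [act, comp_sum, eqToHom_trans_assoc]
  rw [← Fintype.sum_sigma']
  refine Fintype.sum_bijective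
    (fun i => ⟨⟨p.toFun i, i.2⟩, ⟨i, rfl⟩⟩) ⟨?_, ?_⟩ _ _ (fun _ => rfl)
  · intro a b hab
    exact Subtype.ext (congrArg (fun z => z.2.1) hab)
  · rintro ⟨⟨j, hj⟩, ⟨i, hi⟩⟩
    obtain rfl : p.toFun i = j := hi
    exact ⟨⟨i, hj⟩, rfl⟩

theorem comp_act_aux {C : Type u} [Category.{v} C] [CMonEnriched C] {X : C} {Γ : Ctx C}
    (f : ∀ i, Γ.fam i ⟶ X) {Δ Δ' : Fin Γ.len → Ctx C} (p : ∀ i, Δ i ⟶ Δ' i)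
    (g : ∀ i j, (Δ i).fam j ⟶ Γ.fam i) (z : Σ i, Fin (Δ' i).len) :
    act (p z.1) (g z.1) z.2 ≫ f z.1 =
      ∑ a : {a : Σ i, Fin (Δ i).len //
          (⟨a.1, (p a.1).toFun a.2⟩ : Σ i, Fin (Δ' i).len) = z},
        eqToHom ((congrArg (fun z : Σ i, Fin (Δ' i).len => (Δ' z.1).fam z.2) a.2).symm.trans
          ((p a.1.1).w a.1.2)) ≫ g a.1.1 a.1.2 ≫ f a.1.1 := by
  obtain ⟨i, y⟩ := z
  rw [act, sum_comp]
  refine Fintype.sum_bijective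
    (fun x => ⟨⟨i, x.1⟩, congrArg (Sigma.mk i) x.2⟩) ⟨?_, ?_⟩ _ _ (fun _ => Category.assoc _ _ _)
  · intro a b hab
    exact Subtype.ext (eq_of_heq (Sigma.ext_iff.1 (congrArg Subtype.val hab)).2)
  · rintro ⟨⟨i', x⟩, h⟩
    obtain rfl : i' = i := congrArg Sigma.fst h
    exact ⟨⟨x, eq_of_heq (Sigma.ext_iff.1 h).2⟩, rfl⟩

theorem act_comp_aux {C : Type u} [Category.{v} C] [CMonEnriched C] {X : C} {Γ : Ctx C} {n : ℕ}
    (p : Fin n → Fin Γ.len) (f : ∀ i, (Γ.pull p).fam i ⟶ X) {Δ : Fin Γ.len → Ctx C}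
    (g : ∀ i j, (Δ i).fam j ⟶ Γ.fam i) (z : Σ i, Fin (Δ i).len) :
    g z.1 z.2 ≫ act (Γ.pullHom p) f z.1 =
      ∑ a : {a : Σ i, Fin (Δ (p i)).len // (⟨p a.1, a.2⟩ : Σ i, Fin (Δ i).len) = z},
        eqToHom (congrArg (fun z : Σ i, Fin (Δ i).len => (Δ z.1).fam z.2) a.2).symm ≫
          g (p a.1.1) a.1.2 ≫ f a.1.1 := by
  rw [act, comp_sum]
  refine (Fintype.sum_bijective (fun a => ⟨a.1.1, congrArg Sigma.fst a.2⟩) ⟨?_, ?_⟩ _ _ ?_).symm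
  · rintro ⟨⟨i, x⟩, h⟩ ⟨⟨i', x'⟩, h'⟩ hab
    obtain rfl : i = i' := congrArg Subtype.val hab
    obtain rfl : x = x' := eq_of_heq (Sigma.ext_iff.1 (h.trans h'.symm)).2
    rfl
  · obtain ⟨j, y⟩ := z
    rintro ⟨i, h⟩
    obtain rfl : p i = j := h
    exact ⟨⟨⟨i, y⟩, rfl⟩, rfl⟩
  · rintro ⟨⟨i, x⟩, rfl⟩
    refine (Category.id_comp _).trans ?_
    exact congrArg (g (p i) x ≫ ·) (Category.id_comp (f i)).symm

theorem comp_act {C : Type u} [Category.{v} C] [CMonEnriched C] {X : C} {Γ : Ctx C}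
    (f : ∀ i, Γ.fam i ⟶ X) {Δ Δ' : Fin Γ.len → Ctx C} (p : ∀ i, Δ i ⟶ Δ' i)
    (g : ∀ i j, (Δ i).fam j ⟶ Γ.fam i) (t : Fin (Ctx.concat Δ').len) :
    act (p (finSigmaFinEquiv.symm t).1) (g _) (finSigmaFinEquiv.symm t).2 ≫
        f (finSigmaFinEquiv.symm t).1 =
      act (Γ := Ctx.concat Δ) (Ctx.sumHom p) (fun s =>
        g (finSigmaFinEquiv.symm s).1 (finSigmaFinEquiv.symm s).2 ≫
          f (finSigmaFinEquiv.symm s).1) t := by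
  refine (comp_act_aux f p g (finSigmaFinEquiv.symm t)).trans ?_
  exact (@Fintype.sum_equiv _ _ _ (_) (_) _ (finSigmaFinEquiv.symm.subtypeEquiv fun s =>
    (finSigmaFinEquiv.eq_symm_apply).symm) _ _ (fun _ => rfl)).symm

theorem act_comp {C : Type u} [Category.{v} C] [CMonEnriched C] {X : C} {Γ : Ctx C} {n : ℕ}
    (p : Fin n → Fin Γ.len) (f : ∀ i, (Γ.pull p).fam i ⟶ X) {Δ : Fin Γ.len → Ctx C}
    (g : ∀ i j, (Δ i).fam j ⟶ Γ.fam i) (t : Fin (Ctx.concat Δ).len) :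
    g (finSigmaFinEquiv.symm t).1 (finSigmaFinEquiv.symm t).2 ≫
        act (Γ.pullHom p) f (finSigmaFinEquiv.symm t).1 =
      act (Γ := Ctx.concat fun i => Δ (p i)) (Ctx.blockHom p Δ) (fun s =>
        g (p (finSigmaFinEquiv.symm s).1) (finSigmaFinEquiv.symm s).2 ≫
          f (finSigmaFinEquiv.symm s).1) t := by
  refine (act_comp_aux p f g (finSigmaFinEquiv.symm t)).trans ?_
  exact (@Fintype.sum_equiv _ _ _ (_) (_) _ (finSigmaFinEquiv.symm.subtypeEquiv fun s =>
    (finSigmaFinEquiv.eq_symm_apply).symm) _ _ (fun _ => rfl)).symm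

theorem map_act {C D : CMonCat.{v, u}} (F : CMonCat.Functor C D) {X : C.carrier}
    {Γ Δ : Ctx C.carrier} (p : Γ ⟶ Δ) (f : ∀ i, Γ.fam i ⟶ X) (j : Fin Δ.len) :
    F.map (act p f j) =
      act (Γ := Γ.map F.obj) (Ctx.mapHom F.obj p) (fun i => F.map (f i)) j := by
  refine (map_sum (⟨⟨fun g => F.map g, F.map_zero _ _⟩, F.map_add⟩ :
    (Δ.fam j ⟶ X) →+ (F.obj (Δ.fam j) ⟶ F.obj X)) _ _).trans ?_
  refine Finset.sum_congr rfl fun i _ => ?_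
  refine (F.toFunctor.map_comp _ _).trans ?_
  rw [eqToHom_map]

end CMonEnriched

/-- The discrete cocone multicategory of a preadditive category, with its fp-structure:
contractions are given by sums, weakenings by insertions of zeros. -/
def fpCocone (C : CMonCat.{v, u}) : FpMlt.{v, u} where
  toMlt := cocone C.carrier
  act p f := CMonEnriched.act (C := C.carrier) p f
  act_id f := CMonEnriched.act_id (C := C.carrier) f
  act_act p q f := CMonEnriched.act_act (C := C.carrier) p q f
  comp_act f _ _ p g := funext fun t => CMonEnriched.comp_act (C := C.carrier) f p g t
  act_comp p f _ g := funext fun t => CMonEnriched.act_comp (C := C.carrier) p f g t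

/-- The functor `(-)▸`, sending an additive functor `F` to
`⟨f₁, …, fₙ⟩ ↦ ⟨F f₁, …, F fₙ⟩`. -/
def fpCoconeFunctor : CMonCat.{v, u} ⥤ FpMlt.{v, u} where
  obj := fpCocone
  map F :=
    { obj := (CMonCat.Functor.toFunctor F).obj
      map := fun f i => (CMonCat.Functor.toFunctor F).map (f i)
      map_id := fun _ => funext fun _ => (CMonCat.Functor.toFunctor F).map_id _
      map_comp := fun _ _ _ => funext fun _ => (CMonCat.Functor.toFunctor F).map_comp _ _
      map_act := fun p f => funext fun j => CMonEnriched.map_act F p f j }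

namespace Ctx

/-- The morphism `⟨Δ, …, Δ⟩ ⟶ Δ` that is the identity on each of the blocks. -/
def foldHom {O : Type u} (n : ℕ) (Δ : Ctx O) : concat (fun _ : Fin n => Δ) ⟶ Δ :=
  ⟨fun s => (finSigmaFinEquiv.symm s).2, fun _ => rfl⟩

/-- The exchange morphism `⟨X, X⟩ ⟶ ⟨X, X⟩`. -/
def swapHom {O : Type u} (X : O) : replicate 2 X ⟶ replicate 2 X :=
  ⟨Equiv.swap (0 : Fin 2) 1, fun _ => rfl⟩

theorem blk_pos {n : ℕ} {k : Fin n → ℕ} {m : ℕ} (F : ∀ i, Fin (k i) → Fin m)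
    (z : Σ i, Fin (k i)) :
    F (finSigmaFinEquiv.symm (finSigmaFinEquiv z)).1 (finSigmaFinEquiv.symm (finSigmaFinEquiv z)).2
      = F z.1 z.2 := by
  rw [Equiv.symm_apply_apply]

theorem pos_two_zero {k : Fin 2 → ℕ} (x : Fin (k 0)) :
    (finSigmaFinEquiv (⟨0, x⟩ : Σ i, Fin (k i)) : ℕ) = x := by
  rw [finSigmaFinEquiv_apply]
  simp

theorem pos_two_one {k : Fin 2 → ℕ} (x : Fin (k 1)) :
    (finSigmaFinEquiv (⟨1, x⟩ : Σ i, Fin (k i)) : ℕ) = k 0 + x := by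
  rw [finSigmaFinEquiv_apply]
  simp

end Ctx

namespace FpMlt

section
variable {M : FpMlt.{v, u}}

theorem act_congr {Γ Δ Θ : Ctx M.Obj} {X : M.Obj} {f : M.Hom Γ X} {g : M.Hom Δ X}
    (h : (⟨Γ, f⟩ : Σ Θ, M.Hom Θ X) = ⟨Δ, g⟩) (p : Γ ⟶ Θ) (q : Δ ⟶ Θ)
    (hpq : ∀ (i : Fin Γ.len) (j : Fin Δ.len), (i : ℕ) = j → p.toFun i = q.toFun j) : M.act p f = M.act q g := by
  cases h
  obtain rfl : p = q := Ctx.Hom.ext (funext fun i => hpq i i rfl)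
  rfl

/-- For arrows `gᵢ : Δ → Xᵢ` with the same domain and `f : ⟨X₁, …, Xₙ⟩ → X`, the arrow `Δ → X`
obtained from `f(g₁, …, gₙ) : ⟨Δ, …, Δ⟩ → X` by contraction. -/
def subst {Γ Δ : Ctx M.Obj} {X : M.Obj} (f : M.Hom Γ X) (g : ∀ i, M.Hom Δ (Γ.fam i)) :
    M.Hom Δ X :=
  M.act (Ctx.foldHom Γ.len Δ) (M.comp f (Δ := fun _ => Δ) g)

/-- The projection `⟨X₁, …, Xₙ⟩ → Xᵢ`: the identity of `Xᵢ`, weakened. -/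
def proj (Γ : Ctx M.Obj) (i : Fin Γ.len) : M.Hom Γ (Γ.fam i) :=
  M.act (Γ.pullHom (fun _ : Fin 1 => i)) (M.id (Γ.fam i))

theorem subst_comp {Γ Θ : Ctx M.Obj} {X : M.Obj} (f : M.Hom Γ X) {Δ : Fin Γ.len → Ctx M.Obj}
    (g : ∀ i, M.Hom (Δ i) (Γ.fam i)) (h : ∀ i j, M.Hom Θ ((Δ i).fam j)) :
    subst (M.comp f g) (fun s => h (finSigmaFinEquiv.symm s).1 (finSigmaFinEquiv.symm s).2) =
      subst f (fun i => subst (g i) (h i)) := by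
  have h1 : subst f (fun i => subst (g i) (h i)) = M.act (Ctx.foldHom Γ.len Θ)
      (M.act (Ctx.sumHom fun i => Ctx.foldHom (Δ i).len Θ)
        (M.comp f (fun i => M.comp (g i) (Δ := fun _ => Θ) (h i)))) :=
    congrArg (M.act (Ctx.foldHom Γ.len Θ)) (M.comp_act f _ _)
  rw [h1, ← M.act_act]
  refine act_congr (M.assoc f g (Θ := fun _ _ => Θ) h) _ _ fun s t hst => ?_
  obtain rfl : Ctx.assocIso (fun i => (Δ i).len) (fun _ _ => Θ.len) s = t :=
    Fin.ext ((Fin.coe_orderIso_apply _ s).trans hst)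
  refine (congrArg (fun z : Σ _ : (Σ i, Fin (Δ i).len), Fin Θ.len => z.2)
    (Ctx.posR_assocIso (fun i => (Δ i).len) (fun _ _ => Θ.len) s)).symm.trans ?_
  exact (Ctx.blk_pos (fun (_ : Fin Γ.len) (j : Fin Θ.len) => j)
    ⟨(finSigmaFinEquiv.symm (Ctx.assocIso (fun i => (Δ i).len) (fun _ _ => Θ.len) s)).1,
      (finSigmaFinEquiv.symm (finSigmaFinEquiv.symm
        (Ctx.assocIso (fun i => (Δ i).len) (fun _ _ => Θ.len) s)).2).2⟩).symm

theorem subst_act {Γ Θ : Ctx M.Obj} {X : M.Obj} {n : ℕ} (p : Fin n → Fin Γ.len)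
    (f : M.Hom (Γ.pull p) X) (g : ∀ i, M.Hom Θ (Γ.fam i)) :
    subst (M.act (Γ.pullHom p) f) g = subst f (fun i => g (p i)) := by
  have h1 : subst (M.act (Γ.pullHom p) f) g = M.act (Ctx.foldHom Γ.len Θ)
      (M.act (Ctx.blockHom p fun _ => Θ) (M.comp f (Δ := fun _ => Θ) (fun i => g (p i)))) :=
    congrArg (M.act (Ctx.foldHom Γ.len Θ)) (M.act_comp p f g)
  refine h1.trans ((M.act_act _ _ _).symm.trans ?_)
  refine congrArg (fun q => M.act q _) (Ctx.Hom.ext (funext fun s => ?_))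
  exact Ctx.blk_pos (fun (_ : Fin Γ.len) (j : Fin Θ.len) => j) _

theorem subst_id {Θ : Ctx M.Obj} {X : M.Obj} (g : Fin 1 → M.Hom Θ X) :
    subst (M.id X) g = g 0 := by
  obtain ⟨g, rfl⟩ : ∃ g', g = fun _ => g' :=
    ⟨g 0, funext fun i => congrArg g (Subsingleton.elim _ _)⟩
  refine (act_congr (M.id_comp g) _ (𝟙 Θ) fun s t hst => ?_).trans (M.act_id _)
  exact Fin.ext ((Fin.coe_orderIso_apply (Ctx.singleIso Θ.len) s).trans hst)

theorem subst_proj_apply {Γ Θ : Ctx M.Obj} (i : Fin Γ.len) (g : ∀ i, M.Hom Θ (Γ.fam i)) :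
    subst (proj Γ i) g = g i :=
  (subst_act _ _ _).trans (subst_id _)

theorem subst_proj {Γ : Ctx M.Obj} {X : M.Obj} (f : M.Hom Γ X) : subst f (proj Γ) = f := by
  have h1 : subst f (proj Γ) = M.act (Ctx.foldHom Γ.len Γ)
      (M.act (Ctx.sumHom fun i => Γ.pullHom (fun _ : Fin 1 => i))
        (M.comp f (fun i => M.id (Γ.fam i)))) :=
    congrArg (M.act (Ctx.foldHom Γ.len Γ)) (M.comp_act f _ _)
  rw [h1, ← M.act_act]
  refine (act_congr (M.comp_id f) _ (𝟙 Γ) fun s t hst => ?_).trans (M.act_id _)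
  refine (Ctx.blk_pos (fun (_ : Fin Γ.len) (j : Fin Γ.len) => j) _).trans ?_
  exact Fin.ext ((Fin.coe_orderIso_apply (Ctx.unitIso Γ.len) s).trans hst)

theorem subst_subst {Γ Δ Θ : Ctx M.Obj} {X : M.Obj} (f : M.Hom Γ X)
    (g : ∀ i, M.Hom Δ (Γ.fam i)) (h : ∀ i, M.Hom Θ (Δ.fam i)) :
    subst (subst f g) h = subst f (fun i => subst (g i) h) :=
  (subst_act (Γ := Δ) (fun s : Fin (∑ _ : Fin Γ.len, Δ.len) => (finSigmaFinEquiv.symm s).2)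
    (M.comp f (Δ := fun _ => Δ) g) h).trans (subst_comp f g (fun _ => h))

theorem subst_congr {Γ Δ Θ : Ctx M.Obj} {X : M.Obj} {f : M.Hom Γ X} {g : M.Hom Δ X}
    (h : (⟨Γ, f⟩ : Σ Θ, M.Hom Θ X) = ⟨Δ, g⟩) (H : ∀ i, M.Hom Θ (Γ.fam i))
    (H' : ∀ i, M.Hom Θ (Δ.fam i)) (hH : ∀ (i : Fin Γ.len) (j : Fin Δ.len), (i : ℕ) = j → H i ≍ H' j) :
    subst f H = subst g H' := by
  cases h
  obtain rfl : H = H' := funext fun i => eq_of_heq (hH i i rfl)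
  rfl

theorem sigma_ext {Γ Δ : Ctx M.Obj} {X : M.Obj} {f : M.Hom Γ X} {g : M.Hom Δ X}
    (hl : Γ.len = Δ.len) (hf : ∀ (i : Fin Γ.len) (j : Fin Δ.len), (i : ℕ) = j → Γ.fam i = Δ.fam j)
    (h : ∀ {Θ : Ctx M.Obj} (H : ∀ i, M.Hom Θ (Γ.fam i)) (H' : ∀ i, M.Hom Θ (Δ.fam i)),
      (∀ (i : Fin Γ.len) (j : Fin Δ.len), (i : ℕ) = j → H i ≍ H' j) → subst f H = subst g H') :
    (⟨Γ, f⟩ : Σ Θ, M.Hom Θ X) = ⟨Δ, g⟩ := by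
  obtain ⟨n, Γ⟩ := Γ
  obtain ⟨m, Δ⟩ := Δ
  obtain rfl : n = m := hl
  obtain rfl : Γ = Δ := funext fun i => hf i i rfl
  have := h (proj _) (proj _) fun i j hij => by
    obtain rfl := Fin.ext hij
    rfl
  rw [subst_proj, subst_proj] at this
  rw [this]

theorem subst_comp_replicate {Γ Θ : Ctx M.Obj} {X Y : M.Obj} (f : M.Hom Γ X) {k : Fin Γ.len → ℕ}
    (g : ∀ i, M.Hom (Ctx.replicate (k i) Y) (Γ.fam i)) (H : Fin (∑ i, k i) → M.Hom Θ Y) :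
    subst (M.comp f g) H =
      subst f (fun i => subst (g i) (fun j => H (finSigmaFinEquiv ⟨i, j⟩))) := by
  refine Eq.trans ?_ (subst_comp f g (fun i j => H (finSigmaFinEquiv ⟨i, j⟩)))
  exact congrArg (subst (M.comp f g)) (funext fun s =>
    (congrArg H (finSigmaFinEquiv.apply_symm_apply s)).symm)

/-- The composite of a unary arrow `f : X → Y` and an arrow `a : Θ → X`. -/
def app {Θ : Ctx M.Obj} {X Y : M.Obj} (f : M.Hom (Ctx.replicate 1 X) Y) (a : M.Hom Θ X) :
    M.Hom Θ Y :=
  subst f (fun _ => a)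

theorem subst_unary {Θ : Ctx M.Obj} {X Y : M.Obj} (f : M.Hom (Ctx.replicate 1 X) Y)
    (g : Fin 1 → M.Hom Θ X) : subst f g = app f (g 0) :=
  congrArg (subst f) (funext fun i => congrArg g (Subsingleton.elim i 0))

theorem id_app {Θ : Ctx M.Obj} {X : M.Obj} (a : M.Hom Θ X) : app (M.id X) a = a :=
  subst_id _

theorem app_id {X Y : M.Obj} (f : M.Hom (Ctx.replicate 1 X) Y) : app f (M.id X) = f := by
  refine Eq.trans ?_ (subst_proj f)
  refine Eq.trans ?_ (subst_unary f _).symm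
  refine congrArg (app f) ?_
  refine Eq.trans (M.act_id _).symm (congrArg (fun q => M.act q (M.id X)) ?_)
  exact Ctx.Hom.ext (funext fun i : Fin 1 => Subsingleton.elim (α := Fin 1) _ _)

theorem app_app {Θ : Ctx M.Obj} {X Y Z : M.Obj} (g : M.Hom (Ctx.replicate 1 Y) Z)
    (f : M.Hom (Ctx.replicate 1 X) Y) (a : M.Hom Θ X) : app (app g f) a = app g (app f a) :=
  subst_subst _ _ _

/-- Two arrows `⟨Y, …, Y⟩ → X`, considered as a family indexed by `Fin 2`. -/
def pair {a b : ℕ} {X Y : M.Obj} (f : M.Hom (Ctx.replicate a Y) X)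
    (g : M.Hom (Ctx.replicate b Y) X) : ∀ i : Fin 2, M.Hom (Ctx.replicate (![a, b] i) Y) X :=
  Fin.cases f (Fin.cases g fun i => i.elim0)

end

/-- A commutative monoid in a cartesian multicategory: an object `X` with a multiplication
`⟨X, X⟩ → X` and a unit `⟨⟩ → X`. -/
structure CommMon (M : FpMlt.{v, u}) where
  X : M.Obj
  mul : M.Hom (Ctx.replicate 2 X) X
  one : M.Hom (Ctx.replicate 0 X) X
  mul_assoc : (⟨_, M.comp mul (pair mul (M.id X))⟩ : Σ Θ, M.Hom Θ X) =
    ⟨_, M.comp mul (pair (M.id X) mul)⟩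
  one_mul : (⟨_, M.comp mul (pair one (M.id X))⟩ : Σ Θ, M.Hom Θ X) = ⟨_, M.id X⟩
  mul_one : (⟨_, M.comp mul (pair (M.id X) one)⟩ : Σ Θ, M.Hom Θ X) = ⟨_, M.id X⟩
  mul_comm : M.act (Ctx.swapHom X) mul = mul

namespace CommMon
variable {M : FpMlt.{v, u}}

/-- A morphism of commutative monoids: a unary arrow `f` such that `f(m) = m(f, f)` and
`f(e) = e`. -/
@[ext]
structure Hom (A B : CommMon M) where
  hom : M.Hom (Ctx.replicate 1 A.X) B.X
  map_mul : (⟨_, M.comp hom (fun _ => A.mul)⟩ : Σ Θ, M.Hom Θ B.X) =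
    ⟨_, M.comp B.mul (fun _ => hom)⟩
  map_one : (⟨_, M.comp hom (fun _ => A.one)⟩ : Σ Θ, M.Hom Θ B.X) = ⟨_, B.one⟩

/-- The sum `v₂ m₂(a, b)` of two arrows from `Θ` to a commutative monoid. -/
def add (A : CommMon M) {Θ : Ctx M.Obj} (a b : M.Hom Θ A.X) : M.Hom Θ A.X :=
  subst A.mul (fun i : Fin 2 => ![a, b] i)

/-- The zero arrow `v₀ m₀` from `Θ` to a commutative monoid. -/
def zero (A : CommMon M) (Θ : Ctx M.Obj) : M.Hom Θ A.X :=
  subst A.one (fun i => i.elim0)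

theorem subst_mul (A : CommMon M) {Θ : Ctx M.Obj} (g : Fin 2 → M.Hom Θ A.X) :
    subst A.mul g = A.add (g 0) (g 1) :=
  congrArg (subst A.mul) (List.ofFn_inj.mp rfl)

theorem subst_one (A : CommMon M) {Θ : Ctx M.Obj} (g : Fin 0 → M.Hom Θ A.X) :
    subst A.one g = A.zero Θ :=
  congrArg (subst A.one) (funext fun i => i.elim0)

theorem add_subst (A : CommMon M) {Θ Ξ : Ctx M.Obj} (a b : M.Hom Θ A.X)
    (g : ∀ i, M.Hom Ξ (Θ.fam i)) : subst (A.add a b) g = A.add (subst a g) (subst b g) :=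
  (subst_subst _ _ _).trans (subst_mul A _)

theorem zero_subst (A : CommMon M) {Θ Ξ : Ctx M.Obj} (g : ∀ i, M.Hom Ξ (Θ.fam i)) :
    subst (A.zero Θ) g = A.zero Ξ :=
  (subst_subst _ _ _).trans (subst_one A _)

theorem add_comm (A : CommMon M) {Θ : Ctx M.Obj} (a b : M.Hom Θ A.X) :
    A.add a b = A.add b a := by
  have h := subst_act (M := M) (Γ := Ctx.replicate 2 A.X) (Equiv.swap (0 : Fin 2) 1) A.mul
    (fun i : Fin 2 => ![a, b] i)
  have h' : M.act ((Ctx.replicate 2 A.X).pullHom (Equiv.swap (0 : Fin 2) 1)) A.mul = A.mul :=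
    A.mul_comm
  rw [h'] at h
  exact h.trans (subst_mul A _)

theorem add_assoc (A : CommMon M) {Θ : Ctx M.Obj} (a b c : M.Hom Θ A.X) :
    A.add (A.add a b) c = A.add a (A.add b c) := by
  let H : ℕ → M.Hom Θ A.X := fun n => if n = 0 then a else if n = 1 then b else c
  have h := subst_congr A.mul_assoc (fun s => H s) (fun s => H s)
    fun i j hij => heq_of_eq (congrArg H hij)
  have h1 := (subst_comp_replicate (k := ![2, 1]) A.mul (pair A.mul (M.id A.X))
    (fun s => H s)).symm.trans (h.trans (subst_comp_replicate (k := ![1, 2]) A.mul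
    (pair (M.id A.X) A.mul) (fun s => H s)))
  refine Eq.trans ?_ (h1.trans ?_)
  · refine Eq.trans ?_ (subst_mul A _).symm
    refine congrArg₂ A.add ?_ ?_
    · refine Eq.trans ?_ (subst_mul A _).symm
      exact congrArg₂ A.add (congrArg H (Ctx.pos_two_zero (k := ![2, 1]) (0 : Fin 2))).symm
        (congrArg H (Ctx.pos_two_zero (k := ![2, 1]) (1 : Fin 2))).symm
    · refine Eq.trans ?_ (subst_id _).symm
      exact (congrArg H (Ctx.pos_two_one (k := ![2, 1]) (0 : Fin 1))).symm
  · refine (subst_mul A _).trans ?_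
    refine congrArg₂ A.add ?_ ?_
    · refine (subst_id _).trans ?_
      exact congrArg H (Ctx.pos_two_zero (k := ![1, 2]) (0 : Fin 1))
    · refine (subst_mul A _).trans ?_
      exact congrArg₂ A.add (congrArg H (Ctx.pos_two_one (k := ![1, 2]) (0 : Fin 2)))
        (congrArg H (Ctx.pos_two_one (k := ![1, 2]) (1 : Fin 2)))

theorem zero_add (A : CommMon M) {Θ : Ctx M.Obj} (a : M.Hom Θ A.X) :
    A.add (A.zero Θ) a = a := by
  have h := subst_congr A.one_mul (fun _ => a) (fun _ => a) fun _ _ _ => HEq.rfl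
  have h1 := (subst_comp_replicate (k := ![0, 1]) A.mul (pair A.one (M.id A.X))
    (fun _ => a)).symm.trans (h.trans (subst_id _))
  refine Eq.trans ?_ h1
  refine Eq.trans ?_ (subst_mul A _).symm
  exact congrArg₂ A.add (subst_one A _).symm (subst_id (fun _ => a)).symm

theorem add_zero (A : CommMon M) {Θ : Ctx M.Obj} (a : M.Hom Θ A.X) :
    A.add a (A.zero Θ) = a :=
  (A.add_comm _ _).trans (A.zero_add a)

theorem add_add_add_comm (A : CommMon M) {Θ : Ctx M.Obj} (a b c d : M.Hom Θ A.X) :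
    A.add (A.add a b) (A.add c d) = A.add (A.add a c) (A.add b d) := by
  rw [A.add_assoc, A.add_assoc, ← A.add_assoc b, ← A.add_assoc c, A.add_comm b]

theorem add_app (A : CommMon M) {Θ : Ctx M.Obj} {X : M.Obj}
    (f g : M.Hom (Ctx.replicate 1 X) A.X) (a : M.Hom Θ X) :
    app (A.add f g) a = A.add (app f a) (app g a) :=
  add_subst _ _ _ _

theorem zero_app (A : CommMon M) {Θ : Ctx M.Obj} {X : M.Obj} (a : M.Hom Θ X) :
    app (A.zero (Ctx.replicate 1 X)) a = A.zero Θ :=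
  zero_subst _ _

namespace Hom
variable {A B C : CommMon M}

theorem app_add (f : Hom A B) {Θ : Ctx M.Obj} (a b : M.Hom Θ A.X) :
    app f.hom (A.add a b) = B.add (app f.hom a) (app f.hom b) := by
  let H : ℕ → M.Hom Θ A.X := fun n => if n = 0 then a else b
  have h := subst_congr f.map_mul (fun s => H s) (fun s => H s)
    fun i j hij => heq_of_eq (congrArg H hij)
  have h1 := (subst_comp_replicate (k := fun _ => 2) f.hom (fun _ => A.mul)
    (fun s => H s)).symm.trans (h.trans (subst_comp_replicate (k := fun _ => 1) B.mul
    (fun _ => f.hom) (fun s => H s)))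
  refine Eq.trans ?_ (h1.trans ?_)
  · refine Eq.trans ?_ (subst_unary f.hom _).symm
    refine congrArg (app f.hom) (Eq.trans ?_ (subst_mul A _).symm)
    exact congrArg₂ A.add
      (congrArg H (finSigmaFinEquiv_one (n := fun _ => 2) ⟨0, 0⟩)).symm
      (congrArg H (finSigmaFinEquiv_one (n := fun _ => 2) ⟨0, 1⟩)).symm
  · refine (subst_mul B _).trans ?_
    refine congrArg₂ B.add ?_ ?_
    · refine (subst_unary f.hom _).trans (congrArg (app f.hom) ?_)
      exact congrArg H (Ctx.pos_two_zero (k := fun _ => 1) 0)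
    · refine (subst_unary f.hom _).trans (congrArg (app f.hom) ?_)
      exact congrArg H (Ctx.pos_two_one (k := fun _ => 1) 0)

theorem app_zero (f : Hom A B) (Θ : Ctx M.Obj) : app f.hom (A.zero Θ) = B.zero Θ := by
  have e : ∀ s : Fin (∑ _ : Fin 1, 0), False := fun s => (finSigmaFinEquiv.symm s).2.elim0
  have h := subst_congr (Θ := Θ) f.map_one (fun s => (e s).elim) (fun s : Fin 0 => s.elim0)
    fun i _ _ => (e i).elim
  have h1 := (subst_comp_replicate (k := fun _ => 0) f.hom (fun _ => A.one)
    (fun s => (e s).elim)).symm.trans (h.trans (subst_one B _))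
  refine Eq.trans ?_ h1
  exact congrArg (subst f.hom) (funext fun i => (subst_one A _).symm)

/-- A unary arrow is a morphism of commutative monoids when composition with it is additive on
arrows from any `Θ`. -/
def ofApp (f : M.Hom (Ctx.replicate 1 A.X) B.X)
    (hadd : ∀ (Θ : Ctx M.Obj) (a b : M.Hom Θ A.X),
      app f (A.add a b) = B.add (app f a) (app f b))
    (hzero : ∀ Θ, app f (A.zero Θ) = B.zero Θ) : Hom A B where
  hom := f
  map_mul := by
    refine sigma_ext rfl (fun _ _ _ => rfl) fun {Θ} H H' hH => ?_
    refine (subst_comp_replicate (k := fun _ => 2) f (fun _ => A.mul) H).trans (Eq.trans ?_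
      (subst_comp_replicate (k := fun _ => 1) B.mul (fun _ => f) H').symm)
    refine Eq.trans ?_ (subst_mul B _).symm
    refine (subst_unary f _).trans ((congrArg (app f) (subst_mul A _)).trans ?_)
    refine (hadd _ _ _).trans ?_
    refine congrArg₂ B.add ?_ ?_
    · refine Eq.trans (congrArg (app f) ?_) (subst_unary f _).symm
      exact eq_of_heq (hH _ _ ((finSigmaFinEquiv_one (n := fun _ => 2) ⟨0, 0⟩).trans
        (Ctx.pos_two_zero (k := fun _ => 1) 0).symm))
    · refine Eq.trans (congrArg (app f) ?_) (subst_unary f _).symm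
      exact eq_of_heq (hH _ _ ((finSigmaFinEquiv_one (n := fun _ => 2) ⟨0, 1⟩).trans
        (Ctx.pos_two_one (k := fun _ => 1) 0).symm))
  map_one := by
    have e : ∀ s : Fin (∑ _ : Fin 1, 0), False := fun s => (finSigmaFinEquiv.symm s).2.elim0
    refine sigma_ext rfl (fun s => (e s).elim) fun H H' _ => ?_
    refine (subst_comp_replicate (k := fun _ => 0) f (fun _ => A.one) H).trans (Eq.trans ?_
      (subst_one B _).symm)
    refine Eq.trans ?_ (hzero _)
    exact congrArg (subst f) (funext fun i => subst_one A _)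

end Hom

/-- The category of commutative monoids in a cartesian multicategory. -/
instance : Category (CommMon M) where
  Hom := Hom
  id A := Hom.ofApp (M.id A.X)
    (fun _ a b => by rw [id_app, id_app, id_app]) (fun _ => id_app _)
  comp f g := Hom.ofApp (app g.hom f.hom)
    (fun _ a b => by rw [app_app, app_app, app_app, Hom.app_add, Hom.app_add])
    (fun _ => by rw [app_app, Hom.app_zero, Hom.app_zero])
  id_comp _ := Hom.ext (app_id _)
  comp_id _ := Hom.ext (id_app _)
  assoc _ _ _ := Hom.ext (app_app _ _ _).symm

/-- The sum `v₂ m₂(f, g)` of morphisms `f, g : A ⟶ B` of commutative monoids. -/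
instance (A B : CommMon M) : Add (A ⟶ B) where
  add f g := Hom.ofApp (B.add f.hom g.hom)
    (fun _ a b => by
      rw [add_app, add_app, add_app, Hom.app_add, Hom.app_add, add_add_add_comm])
    (fun _ => by rw [add_app, Hom.app_zero, Hom.app_zero, zero_add])

/-- The zero morphism `v₀ m₀`. -/
instance (A B : CommMon M) : Zero (A ⟶ B) where
  zero := Hom.ofApp (B.zero _)
    (fun _ a b => by rw [zero_app, zero_app, zero_app, zero_add])
    (fun _ => zero_app _ _)

instance (A B : CommMon M) : AddCommMonoid (A ⟶ B) where
  add_assoc _ _ _ := Hom.ext (B.add_assoc _ _ _)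
  zero_add _ := Hom.ext (B.zero_add _)
  add_zero _ := Hom.ext (B.add_zero _)
  add_comm _ _ := Hom.ext (B.add_comm _ _)
  nsmul := nsmulRec

instance : CMonEnriched (CommMon M) where
  addCommMonoid := inferInstance
  add_comp _ _ h := Hom.ext (h.app_add _ _)
  comp_add _ _ _ := Hom.ext (add_app _ _ _ _)
  zero_comp h := Hom.ext (h.app_zero _)
  comp_zero _ := Hom.ext (zero_app _ _)

/-- The mapping of arrows with codomain `X`, together with their domains, induced by a functor. -/
def mapSigma {M N : FpMlt.{v, u}} (F : Functor M N) {X : M.Obj} (z : Σ Θ, M.Hom Θ X) :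
    Σ Θ, N.Hom Θ (F.obj X) :=
  ⟨z.1.map F.obj, F.map z.2⟩

theorem map_pair {M N : FpMlt.{v, u}} (F : Functor M N) {X : M.Obj} {a b : ℕ}
    (m : M.Hom (Ctx.replicate 2 X) X)
    (f : M.Hom (Ctx.replicate a X) X) (g : M.Hom (Ctx.replicate b X) X) :
    (⟨_, N.comp (Γ := Ctx.replicate 2 (F.obj X)) (F.map m)
      (pair (M := N) (Y := F.obj X) (F.map f) (F.map g))⟩ : Σ Θ, N.Hom Θ (F.obj X)) =
      mapSigma F ⟨_, M.comp m (pair f g)⟩ := by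
  refine Eq.trans ?_ (congrArg (Sigma.mk _) (F.map_comp m (pair f g)).symm)
  refine congrArg (Sigma.mk _) ?_
  refine congrArg (N.comp (Γ := Ctx.replicate 2 (F.obj X)) (F.map m)
    (Δ := fun i => Ctx.replicate (![a, b] i) (F.obj X))) ?_
  exact funext fun i => Fin.cases rfl (Fin.cases rfl fun i => i.elim0) i

/-- The image of a commutative monoid under an fp-functor. -/
def map {M N : FpMlt.{v, u}} (F : Functor M N) (A : CommMon M) : CommMon N where
  X := F.obj A.X
  mul := F.map A.mul
  one := F.map A.one
  mul_assoc := by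
    rw [← F.map_id]
    exact (map_pair F _ _ _).trans ((congrArg (mapSigma F) A.mul_assoc).trans
      (map_pair F _ _ _).symm)
  one_mul := by
    rw [← F.map_id]
    exact (map_pair F _ _ _).trans (congrArg (mapSigma F) A.one_mul)
  mul_one := by
    rw [← F.map_id]
    exact (map_pair F _ _ _).trans (congrArg (mapSigma F) A.mul_one)
  mul_comm := (F.map_act (Ctx.swapHom A.X) A.mul).symm.trans (congrArg F.map A.mul_comm)

theorem map_subst {M N : FpMlt.{v, u}} (F : Functor M N) {Γ Δ : Ctx M.Obj} {X : M.Obj}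
    (f : M.Hom Γ X) (g : ∀ i, M.Hom Δ (Γ.fam i)) :
    F.map (subst f g) = subst (F.map f) (fun i => F.map (g i)) :=
  (F.map_act _ _).trans (congrArg (N.act _) (F.map_comp f g))

theorem map_add {M N : FpMlt.{v, u}} (F : Functor M N) (A : CommMon M) {Θ : Ctx M.Obj}
    (a b : M.Hom Θ A.X) : F.map (A.add a b) = (A.map F).add (F.map a) (F.map b) :=
  (map_subst F _ _).trans (subst_mul (A.map F) _)

theorem map_zero {M N : FpMlt.{v, u}} (F : Functor M N) (A : CommMon M) (Θ : Ctx M.Obj) :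
    F.map (A.zero Θ) = (A.map F).zero (Θ.map F.obj) :=
  (map_subst F _ _).trans (subst_one (A.map F) _)

/-- The image of a morphism of commutative monoids under an fp-functor. -/
def Hom.map {M N : FpMlt.{v, u}} (F : Functor M N) {A B : CommMon M} (f : Hom A B) :
    Hom (A.map F) (B.map F) where
  hom := F.map f.hom
  map_mul := Eq.trans (congrArg (Sigma.mk _) (F.map_comp f.hom (fun _ => A.mul)).symm)
    ((congrArg (mapSigma F) f.map_mul).trans
      (congrArg (Sigma.mk _) (F.map_comp B.mul (fun _ => f.hom))))
  map_one := Eq.trans (congrArg (Sigma.mk _) (F.map_comp f.hom (fun _ => A.one)).symm)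
    (congrArg (mapSigma F) f.map_one)

end CommMon

/-- The functor `cMon(-)`, sending a cartesian multicategory to the preadditive category of its
commutative monoids. -/
def cMon : FpMlt.{v, u} ⥤ CMonCat.{v, max u v} where
  obj M := ⟨CommMon M⟩
  map F :=
    { obj := fun A => A.map F
      map := fun f => CommMon.Hom.map F f
      map_id := fun A => CommMon.Hom.ext (Mlt.Functor.map_id (Functor.toFunctor F) A.X)
      map_comp := fun f g => CommMon.Hom.ext (CommMon.map_subst F _ _)
      map_add := fun f g => CommMon.Hom.ext (CommMon.map_add F _ _ _)
      map_zero := fun A B => CommMon.Hom.ext (CommMon.map_zero F _ _) }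

/-- The cartesian multicategories whose underlying multicategory is isomorphic to the discrete
cocone multicategory of some category. -/
def isCocone : ObjectProperty FpMlt.{v, u} := fun M =>
  ∃ (C : Type u) (_ : Category.{v} C), Nonempty (forget.obj M ≅ cocone C)

theorem isCocone_fpCocone (C : CMonCat.{v, u}) : isCocone (fpCoconeFunctor.obj C) :=
  ⟨C.carrier, inferInstance, ⟨Iso.refl _⟩⟩

/-- The functor `(-)▸`, with values in the full subcategory of the cartesian multicategories
whose underlying multicategory is a discrete cocone multicategory. -/
def toCocones : CMonCat.{v, u} ⥤ (isCocone.{v, u}).FullSubcategory :=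
  isCocone.lift fpCoconeFunctor isCocone_fpCocone

end FpMlt

/-! Call an arrow `Θ → X` an element of `X` over `Θ`. By contracted composition (`subst`) an arrow
`⟨X₁, …, Xₙ⟩ → X` acts on tuples of elements, and it is recovered by substituting the projections.
So a cartesian multicategory can be handled like a clone of operations, with laws checked on
elements (`hom_ext`). The elements of a commutative monoid over a fixed `Θ` form an ordinary
commutative monoid, where finite sums make sense.

Adjunction: an additive functor `F` from `C` to commutative monoids of `M` extends to `C▸` by
sending `⟨f₁, …, fₙ⟩` to the operation `h ↦ ∑ F(fᵢ)(hᵢ)` (`lift`, `substHom_liftMap`). Composition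
is respected because each `F(fᵢ)` is additive, the action of mappings because `F` is. Conversely,
each object of `C▸` is a commutative monoid under `⟨1, 1⟩`, and fp-functors preserve commutative
monoids. Every arrow of `C▸` is the sum of its weakened terms, so an fp-functor on `C▸` is
determined by its values on unary arrows (`map_eq_sum`). The unit laws force the multiplication of
any commutative monoid in `D▸` to be `⟨1, 1⟩` (`term_mul`); with the same decomposition this makes
`(-)▸` fully faithful.

Essential image: only the underlying multicategory of `M` is assumed isomorphic to some `C▸`. There
is then exactly one arrow `⟨⟩ → X`, which provides zeros, and the `i`-th term of an arrow can be
read off after substituting an identity at place `i` and zeros elsewhere (`term_restrict`). Hence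
arrows amount to families of such restrictions. The arrow `⟨X, X⟩ → X` with both restrictions equal
to `1` is a commutative monoid structure preserved by all unary arrows, and lifting the category of
unary arrows yields an isomorphism onto `M` (`isoCocone`). The coreflection is the adjunction
transported along the resulting equivalence. -/

/-! ### Families and mappings of finite sequences. -/

namespace Ctx

/-- A dependent family indexed by the positions of a concatenation is a twofold family. -/
theorem exists_concat_family {O : Type u} {n : ℕ} (Δ : Fin n → Ctx O) (P : O → Type v)
    (h : ∀ s, P ((concat Δ).fam s)) : ∃ h' : ∀ i j, P ((Δ i).fam j),
      h = fun s : Fin (∑ i, (Δ i).len) =>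
        h' (finSigmaFinEquiv.symm s).1 (finSigmaFinEquiv.symm s).2 := by
  obtain ⟨k, hk⟩ := (Equiv.piCongrLeft (fun z : Σ i, Fin (Δ i).len => P ((Δ z.1).fam z.2))
    finSigmaFinEquiv.symm).symm.surjective h
  exact ⟨fun i j => k ⟨i, j⟩, hk.symm⟩

/-- Every morphism of `N / O` is of the form `pullHom`. -/
theorem pullHom_induction {O : Type u} {Δ : Ctx O} {P : ∀ Γ : Ctx O, (Γ ⟶ Δ) → Prop}
    (h : ∀ (n : ℕ) (q : Fin n → Fin Δ.len), P (Δ.pull q) (Δ.pullHom q))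
    {Γ : Ctx O} (p : Γ ⟶ Δ) : P Γ p := by
  obtain ⟨n, Γ⟩ := Γ
  obtain ⟨q, hq⟩ := p
  change Fin n → Fin Δ.len at q
  change ∀ i, Δ.fam (q i) = Γ i at hq
  -- The domain is forced by `q`, so it can be eliminated together with all transports along it.
  obtain rfl : (fun i => Δ.fam (q i)) = Γ := funext hq
  exact h n q

end Ctx

/-! ### Laws checked on elements, and the commutative monoids of elements. -/

namespace FpMlt
variable {M : FpMlt.{v, u}}

/-- The tuple of projections is a generic element: substituting it returns the arrow itself. -/
theorem hom_ext {Γ : Ctx M.Obj} {X : M.Obj} {f g : M.Hom Γ X}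
    (h : ∀ {Θ : Ctx M.Obj} (H : ∀ i, M.Hom Θ (Γ.fam i)), subst f H = subst g H) : f = g :=
  (subst_proj f).symm.trans ((h _).trans (subst_proj g))

/-- The operation on the arrows from `Θ` to `X` induced by an arrow `⟨X, X⟩ → X`. -/
def op {X Y : M.Obj} (m : M.Hom (Ctx.replicate 2 X) Y) {Θ : Ctx M.Obj} (a b : M.Hom Θ X) :
    M.Hom Θ Y :=
  subst m (fun i : Fin 2 => ![a, b] i)

theorem subst_two {X Y : M.Obj} (m : M.Hom (Ctx.replicate 2 X) Y) {Θ : Ctx M.Obj}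
    (g : Fin 2 → M.Hom Θ X) : subst m g = op m (g 0) (g 1) :=
  congrArg (subst m) (List.ofFn_inj.mp rfl)

theorem op_subst {X Y : M.Obj} (m : M.Hom (Ctx.replicate 2 X) Y) {Θ Ξ : Ctx M.Obj}
    (a b : M.Hom Θ X) (g : ∀ i, M.Hom Ξ (Θ.fam i)) :
    subst (op m a b) g = op m (subst a g) (subst b g) :=
  (subst_subst _ _ _).trans (subst_two _ _)

/-- The weakening `Θ → X` of an arrow `⟨⟩ → X`. -/
def weaken {X : M.Obj} (e : M.Hom (Ctx.replicate 0 X) X) (Θ : Ctx M.Obj) : M.Hom Θ X :=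
  subst e (fun i => i.elim0)

theorem subst_nullary {X : M.Obj} (e : M.Hom (Ctx.replicate 0 X) X) {Θ : Ctx M.Obj}
    (g : Fin 0 → M.Hom Θ X) : subst e g = weaken e Θ :=
  congrArg (subst e) (funext fun i => i.elim0)

theorem weaken_subst {X : M.Obj} (e : M.Hom (Ctx.replicate 0 X) X) {Θ Ξ : Ctx M.Obj}
    (g : ∀ i, M.Hom Ξ (Θ.fam i)) : subst (weaken e Θ) g = weaken e Ξ :=
  (subst_subst _ _ _).trans (subst_nullary _ _)

namespace CommMon

/-- A commutative monoid in `M` from operations that satisfy the laws on arrows from any `Θ`. -/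
def ofLaws (X : M.Obj) (mul : M.Hom (Ctx.replicate 2 X) X) (one : M.Hom (Ctx.replicate 0 X) X)
    (op_assoc : ∀ {Θ : Ctx M.Obj} (a b c : M.Hom Θ X),
      op mul (op mul a b) c = op mul a (op mul b c))
    (op_zero : ∀ {Θ : Ctx M.Obj} (a : M.Hom Θ X), op mul a (weaken one Θ) = a)
    (op_comm : ∀ {Θ : Ctx M.Obj} (a b : M.Hom Θ X), op mul a b = op mul b a) :
    CommMon M where
  X := X
  mul := mul
  one := one
  mul_assoc := by
    refine sigma_ext rfl (fun _ _ _ => rfl) fun {Θ} H H' hH => ?_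
    refine (subst_comp_replicate (k := ![2, 1]) mul (pair mul (M.id X)) H).trans (Eq.trans ?_
      (subst_comp_replicate (k := ![1, 2]) mul (pair (M.id X) mul) H').symm)
    refine (subst_two _ _).trans (Eq.trans ?_ (subst_two _ _).symm)
    refine (congrArg₂ (op mul) (subst_two mul _) (subst_id _)).trans
      ((op_assoc _ _ _).trans (Eq.trans ?_
        (congrArg₂ (op mul) (subst_id _) (subst_two mul _)).symm))
    -- The places 0, 1, 2 lie in blocks of lengths 2, 1 on one side and 1, 2 on the other; `H` and
    -- `H'` agree at equal numerical positions.
    refine congrArg₂ (op mul) ?_ (congrArg₂ (op mul) ?_ ?_)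
    · exact eq_of_heq (hH _ _ ((Ctx.pos_two_zero (k := ![2, 1]) (0 : Fin 2)).trans
        (Ctx.pos_two_zero (k := ![1, 2]) (0 : Fin 1)).symm))
    · exact eq_of_heq (hH _ _ ((Ctx.pos_two_zero (k := ![2, 1]) (1 : Fin 2)).trans
        (Ctx.pos_two_one (k := ![1, 2]) (0 : Fin 2)).symm))
    · exact eq_of_heq (hH _ _ ((Ctx.pos_two_one (k := ![2, 1]) (0 : Fin 1)).trans
        (Ctx.pos_two_one (k := ![1, 2]) (1 : Fin 2)).symm))
  one_mul := by
    refine sigma_ext rfl (fun _ _ _ => rfl) fun {Θ} H H' hH => ?_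
    refine (subst_comp_replicate (k := ![0, 1]) mul (pair one (M.id X)) H).trans (Eq.trans ?_
      (subst_id H').symm)
    refine (subst_two _ _).trans ((congrArg₂ (op mul) (subst_nullary one _) (subst_id _)).trans
      ((op_comm _ _).trans ((op_zero _).trans ?_)))
    exact eq_of_heq (hH _ _ (Ctx.pos_two_one (k := ![0, 1]) (0 : Fin 1)))
  mul_one := by
    refine sigma_ext rfl (fun _ _ _ => rfl) fun {Θ} H H' hH => ?_
    refine (subst_comp_replicate (k := ![1, 0]) mul (pair (M.id X) one) H).trans (Eq.trans ?_
      (subst_id H').symm)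
    refine (subst_two _ _).trans ((congrArg₂ (op mul) (subst_id _) (subst_nullary one _)).trans
      ((op_zero _).trans ?_))
    exact eq_of_heq (hH _ _ (Ctx.pos_two_zero (k := ![1, 0]) (0 : Fin 1)))
  mul_comm := by
    refine hom_ext fun {Θ} H => ?_
    refine (subst_act (M := M) (Γ := Ctx.replicate 2 X) (Equiv.swap (0 : Fin 2) 1) mul H).trans ?_
    exact (subst_two _ _).trans ((op_comm _ _).trans (subst_two mul H).symm)

theorem ext' {A B : CommMon M} (h : A.X = B.X) (hm : A.mul ≍ B.mul) (h1 : A.one ≍ B.one) :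
    A = B := by
  obtain ⟨X, m, e⟩ := A
  obtain ⟨Y, m', e'⟩ := B
  cases h
  cases hm
  cases h1
  rfl

theorem Hom.hext {A B A' B' : CommMon M} (hA : A = A') (hB : B = B') {f : Hom A B}
    {g : Hom A' B'} (h : f.hom ≍ g.hom) : f ≍ g := by
  cases hA
  cases hB
  exact heq_of_eq (Hom.ext (eq_of_heq h))

/-- The arrows from `Θ` to a commutative monoid. -/
def Elt (A : CommMon M) (Θ : Ctx M.Obj) : Type v := M.Hom Θ A.X

instance (A : CommMon M) (Θ : Ctx M.Obj) : Add (A.Elt Θ) := ⟨A.add⟩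

instance (A : CommMon M) (Θ : Ctx M.Obj) : Zero (A.Elt Θ) := ⟨A.zero Θ⟩

instance (A : CommMon M) (Θ : Ctx M.Obj) : AddCommMonoid (A.Elt Θ) where
  add_assoc := A.add_assoc
  zero_add := A.zero_add
  add_zero := A.add_zero
  add_comm := A.add_comm
  nsmul := nsmulRec

/-- Substitution as an additive map. -/
def substHom (A : CommMon M) {Θ Ξ : Ctx M.Obj} (g : ∀ i, M.Hom Ξ (Θ.fam i)) :
    A.Elt Θ →+ A.Elt Ξ where
  toFun a := subst (M := M) (X := A.X) a g
  map_zero' := A.zero_subst g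
  map_add' a b := A.add_subst a b g

/-- Composition with a morphism of commutative monoids as an additive map. -/
def Hom.appHom {A B : CommMon M} (f : Hom A B) (Θ : Ctx M.Obj) : A.Elt Θ →+ B.Elt Θ where
  toFun a := app f.hom a
  map_zero' := f.app_zero Θ
  map_add' a b := f.app_add a b

/-- The evaluation of morphisms of commutative monoids at an arrow as an additive map. -/
def evalHom (A B : CommMon M) {Θ : Ctx M.Obj} (a : A.Elt Θ) : (A ⟶ B) →+ B.Elt Θ where
  toFun f := app (CommMon.Hom.hom f) a
  map_zero' := B.zero_app a
  map_add' f g := B.add_app (Hom.hom f) (Hom.hom g) a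

/-- The additive map induced by an fp-functor. -/
def mapHom {N : FpMlt.{v, u}} (F : Functor M N) (A : CommMon M) (Θ : Ctx M.Obj) :
    A.Elt Θ →+ (A.map F).Elt (Θ.map F.obj) where
  toFun a := F.map (X := A.X) a
  map_zero' := map_zero F A Θ
  map_add' a b := map_add F A a b

end CommMon
end FpMlt

/-! ### The fp-functor on `C▸` induced by an additive functor. -/

namespace FpMlt

namespace CommMon

/-- The object mapping of the fp-functor `C▸ ⟶ M` induced by a functor `C ⥤ CommMon M`. -/
abbrev liftObj {C : Type w} [Category.{v} C] {M : FpMlt.{v, u}} (F : C ⥤ CommMon M) (X : C) :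
    M.Obj :=
  (F.obj X).X

/-- The arrow `⟨F X₁, …, F Xₙ⟩ → F X` that is the sum of the weakened arrows `F fᵢ`. -/
def liftMap {C : Type w} [Category.{v} C] {M : FpMlt.{v, u}} (F : C ⥤ CommMon M) {Γ : Ctx C}
    {X : C} (f : ∀ i, Γ.fam i ⟶ X) : (F.obj X).Elt (Γ.map (liftObj F)) :=
  ∑ i, Hom.appHom (F.map (f i)) _ (proj (Γ.map (liftObj F)) i)

/-- Substitution into a monoid is additive and turns the `i`-th projection into `h i`. All the laws
of `lift` are verified through this linear formula. -/
theorem substHom_liftMap {C : Type w} [Category.{v} C] {M : FpMlt.{v, u}} (F : C ⥤ CommMon M)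
    {Γ : Ctx C} {X : C} (f : ∀ i, Γ.fam i ⟶ X) {Θ : Ctx M.Obj}
    (h : ∀ i, (F.obj (Γ.fam i)).Elt Θ) :
    substHom (F.obj X) (Θ := Γ.map (liftObj F)) h (liftMap F f) =
      ∑ i, Hom.appHom (F.map (f i)) Θ (h i) := by
  rw [liftMap, map_sum]
  refine Finset.sum_congr rfl fun i _ => ?_
  refine (subst_subst _ _ _).trans ?_
  exact congrArg (subst (Hom.hom (F.map (f i)))) (funext fun _ =>
    subst_proj_apply (Γ := Γ.map (liftObj F)) i h)

theorem appHom_comp {C : Type w} [Category.{v} C] {M : FpMlt.{v, u}} (F : C ⥤ CommMon M)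
    {X Y Z : C} (f : X ⟶ Y) (g : Y ⟶ Z) {Θ : Ctx M.Obj} (a : (F.obj X).Elt Θ) :
    Hom.appHom (F.map (f ≫ g)) Θ a = Hom.appHom (F.map g) Θ (Hom.appHom (F.map f) Θ a) := by
  rw [F.map_comp]
  exact app_app _ _ _

theorem appHom_id {C : Type w} [Category.{v} C] {M : FpMlt.{v, u}} (F : C ⥤ CommMon M)
    (X : C) {Θ : Ctx M.Obj} (a : (F.obj X).Elt Θ) : Hom.appHom (F.map (𝟙 X)) Θ a = a := by
  rw [F.map_id]
  exact id_app _

/-- For fixed `a` the assignment is a composite of two additive maps: `F` on arrows, then evaluation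
at `a`. -/
theorem appHom_sum {C : CMonCat.{v, w}} {M : FpMlt.{v, u}} (F : C.carrier ⥤ CommMon M)
    (hadd : ∀ {X Y : C.carrier} (f g : X ⟶ Y), F.map (f + g) = F.map f + F.map g)
    (hzero : ∀ X Y : C.carrier, F.map (0 : X ⟶ Y) = 0) {X Y : C.carrier} {ι : Type*} [Fintype ι]
    (f : ι → (X ⟶ Y)) {Θ : Ctx M.Obj} (a : (F.obj X).Elt Θ) :
    Hom.appHom (F.map (∑ i, f i)) Θ a = ∑ i, Hom.appHom (F.map (f i)) Θ a :=
  map_sum ((evalHom (F.obj X) (F.obj Y) a).comp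
    (⟨⟨fun f => F.map f, hzero X Y⟩, hadd⟩ : (X ⟶ Y) →+ (F.obj X ⟶ F.obj Y))) f _

theorem appHom_act {C : CMonCat.{v, w}} {M : FpMlt.{v, u}} (F : C.carrier ⥤ CommMon M)
    (hadd : ∀ {X Y : C.carrier} (f g : X ⟶ Y), F.map (f + g) = F.map f + F.map g)
    (hzero : ∀ X Y : C.carrier, F.map (0 : X ⟶ Y) = 0) {Δ : Ctx C.carrier} {X : C.carrier} {n : ℕ}
    (q : Fin n → Fin Δ.len) (f : ∀ i, Δ.fam (q i) ⟶ X) {Θ : Ctx M.Obj} (j : Fin Δ.len)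
    (a : (F.obj (Δ.fam j)).Elt Θ) :
    Hom.appHom (F.map (CMonEnriched.act (Δ.pullHom q) f j)) Θ a =
      ∑ i : {i : Fin n // q i = j},
        Hom.appHom (F.map (eqToHom (congrArg Δ.fam i.2).symm ≫ f i)) Θ a :=
  appHom_sum F hadd hzero _ a

/-- The fp-functor `C▸ ⟶ M` induced by an additive functor from `C` to commutative monoids. -/
def lift {C : CMonCat.{v, u}} {M : FpMlt.{v, u}} (F : C.carrier ⥤ CommMon M)
    (hadd : ∀ {X Y : C.carrier} (f g : X ⟶ Y), F.map (f + g) = F.map f + F.map g)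
    (hzero : ∀ X Y : C.carrier, F.map (0 : X ⟶ Y) = 0) : fpCocone C ⟶ M where
  obj := liftObj (C := C.carrier) F
  map {Γ X} f := liftMap (C := C.carrier) F (Γ := Γ) (X := X) f
  map_id X := by
    refine hom_ext fun H => ?_
    refine (substHom_liftMap (C := C.carrier) F (Γ := Ctx.replicate 1 X) (fun _ => CategoryStruct.id (obj := C.carrier) X) H).trans ?_
    rw [Fin.sum_univ_one]
    exact (appHom_id F X _).trans (subst_id (M := M) (X := (F.obj X).X) H).symm
  map_comp {Γ X} f Δ g := by
    refine hom_ext fun {Θ} H => ?_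
    -- In double-index form the family fits `subst_comp`, and the sum over positions becomes a
    -- double sum.
    obtain ⟨H, rfl⟩ := Ctx.exists_concat_family (fun i => (Δ i).map (liftObj F))
      (fun Y => M.Hom Θ Y) H
    refine (substHom_liftMap (C := C.carrier) F (Γ := Ctx.concat Δ) _ _).trans (Eq.trans ?_
      (subst_comp (M := M) (Γ := Γ.map (liftObj F)) _ _ H).symm)
    refine Eq.trans ?_ (substHom_liftMap (C := C.carrier) F (Γ := Γ) f _).symm
    refine (Fintype.sum_equiv finSigmaFinEquiv.symm _ (fun z : Σ i, Fin (Δ i).len =>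
      Hom.appHom (F.map (CategoryStruct.comp (obj := C.carrier) (g z.1 z.2) (f z.1))) Θ (H z.1 z.2)) fun _ => rfl).trans ?_
    rw [Fintype.sum_sigma]
    refine Finset.sum_congr rfl fun i _ => ?_
    refine Eq.trans ?_ (congrArg (Hom.appHom (F.map (f i)) Θ)
      (substHom_liftMap (C := C.carrier) F (Γ := Δ i) (g i) (H i)).symm)
    -- `F (f i)` is a morphism of monoids, so it passes through the inner sum.
    rw [map_sum]
    exact Finset.sum_congr rfl fun j _ => appHom_comp F _ _ _
  map_act {Γ Δ X} p := by
    refine Ctx.pullHom_induction (O := C.carrier) (P := fun Γ p => ∀ f : (fpCocone C).Hom Γ X,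
      (liftMap (C := C.carrier) F (Γ := Δ) (X := X) ((fpCocone C).act p f) : M.Hom _ _) =
        M.act (Ctx.mapHom (liftObj F) p) (liftMap (C := C.carrier) F (Γ := Γ) (X := X) f)) (fun n q f => ?_) p
    refine hom_ext fun {Θ} H => ?_
    refine (substHom_liftMap (C := C.carrier) F (Γ := Δ) _ _).trans (Eq.trans ?_
      (subst_act (M := M) (Γ := Δ.map (liftObj F)) q _ H).symm)
    refine Eq.trans ?_ (substHom_liftMap (C := C.carrier) F (Γ := Δ.pull q) f _).symm
    -- Additivity of `F` on arrows is needed only for this compatibility with the action.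
    refine (Finset.sum_congr rfl fun j _ => appHom_act F hadd hzero q f j (H j)).trans ?_
    rw [← Fintype.sum_sigma']
    -- The fibres of `q` partition its source, so the double sum over fibres is a sum over all `i`.
    refine (Fintype.sum_bijective (fun i : Fin n => ⟨q i, i, rfl⟩) ⟨?_, ?_⟩ _ _ ?_).symm
    · intro a b hab
      exact congrArg (fun z : Σ j, {i : Fin n // q i = j} => z.2.1) hab
    · rintro ⟨j, i, hi⟩
      obtain rfl : q i = j := hi
      exact ⟨i, rfl⟩
    · intro i
      exact congrArg (fun k => Hom.appHom (F.map k) Θ (H (q i))) (Category.id_comp (f i)).symm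

end CommMon
end FpMlt

/-! ### Terms of arrows and commutative monoids in `C▸`. -/

namespace FpMlt

section
variable {C : CMonCat.{v, u}}

instance : Category.{v} (fpCocone C).Obj := C.cat

instance : CMonEnriched (fpCocone C).Obj := C.enriched

/-- The `i`-th term of an arrow of `C▸`. -/
def term {Γ : Ctx (fpCocone C).Obj} {X : (fpCocone C).Obj} (f : (fpCocone C).Hom Γ X)
    (i : Fin Γ.len) : Γ.fam i ⟶ X :=
  f i

/-- The arrow of `C▸` with given terms. -/
def ofTerms {Γ : Ctx (fpCocone C).Obj} {X : (fpCocone C).Obj} (f : ∀ i, Γ.fam i ⟶ X) :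
    (fpCocone C).Hom Γ X :=
  f

theorem term_ext {Γ : Ctx (fpCocone C).Obj} {X : (fpCocone C).Obj} {f g : (fpCocone C).Hom Γ X}
    (h : ∀ i, term f i = term g i) : f = g :=
  funext h

theorem term_ofTerms {Γ : Ctx (fpCocone C).Obj} {X : (fpCocone C).Obj} (f : ∀ i, Γ.fam i ⟶ X)
    (i : Fin Γ.len) : term (ofTerms f) i = f i :=
  rfl

theorem term_act {Γ Δ : Ctx (fpCocone C).Obj} {X : (fpCocone C).Obj} (p : Γ ⟶ Δ)
    (f : (fpCocone C).Hom Γ X) (j : Fin Δ.len) :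
    term ((fpCocone C).act p f) j = ∑ i : {i : Fin Γ.len // p.toFun i = j},
      eqToHom ((congrArg Δ.fam i.2).symm.trans (p.w i)) ≫ term f i :=
  rfl

/-- The fibre of the folding map over `j` has exactly one position in each block, so contraction
yields a matrix product. -/
theorem term_subst {Γ Δ : Ctx (fpCocone C).Obj} {X : (fpCocone C).Obj}
    (f : (fpCocone C).Hom Γ X) (g : ∀ i, (fpCocone C).Hom Δ (Γ.fam i)) (j : Fin Δ.len) :
    term (subst f g) j = ∑ i, term (g i) j ≫ term f i := by
  refine (Fintype.sum_bijective (fun i : Fin Γ.len =>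
    (⟨finSigmaFinEquiv ⟨i, j⟩, congrArg (fun z : Σ _ : Fin Γ.len, Fin Δ.len => z.2)
      (finSigmaFinEquiv.symm_apply_apply _)⟩ : {s : Fin (∑ _ : Fin Γ.len, Δ.len) //
        (finSigmaFinEquiv.symm s).2 = j})) ⟨?_, ?_⟩ _ _ ?_).symm
  · intro a b hab
    exact congrArg Sigma.fst (finSigmaFinEquiv.injective (congrArg Subtype.val hab))
  · rintro ⟨s, rfl⟩
    exact ⟨(finSigmaFinEquiv.symm s).1, Subtype.ext (finSigmaFinEquiv.apply_symm_apply s)⟩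
  · intro i
    -- The block decomposition of the position is only propositionally `⟨i, j⟩`; generalizing it
    -- lets the transport collapse to an identity.
    have key : ∀ (z : Σ _ : Fin Γ.len, Fin Δ.len) (hz : z = ⟨i, j⟩)
        (e : Δ.fam j = Δ.fam z.2), term (g i) j ≫ term f i =
          eqToHom e ≫ term (g z.1) z.2 ≫ term f z.1 := by
      rintro _ rfl e
      exact (Category.id_comp _).symm
    exact key _ (finSigmaFinEquiv.symm_apply_apply _) _

theorem term_op {X Y : (fpCocone C).Obj} (m : (fpCocone C).Hom (Ctx.replicate 2 X) Y)
    {Θ : Ctx (fpCocone C).Obj} (a b : (fpCocone C).Hom Θ X) (j : Fin Θ.len) :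
    term (op m a b) j =
      term a j ≫ term m (0 : Fin 2) + term b j ≫ term m (1 : Fin 2) :=
  (term_subst (Γ := Ctx.replicate 2 X) _ _ j).trans (Fin.sum_univ_two _)

theorem term_weaken {X : (fpCocone C).Obj} (e : (fpCocone C).Hom (Ctx.replicate 0 X) X)
    (Θ : Ctx (fpCocone C).Obj) (j : Fin Θ.len) : term (weaken e Θ) j = 0 :=
  (term_subst (Γ := Ctx.replicate 0 X) _ _ j).trans (Fin.sum_univ_zero _)

theorem term_app {X Y : (fpCocone C).Obj} (f : (fpCocone C).Hom (Ctx.replicate 1 X) Y)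
    {Θ : Ctx (fpCocone C).Obj} (a : (fpCocone C).Hom Θ X) (j : Fin Θ.len) :
    term (app f a) j = term a j ≫ term f (0 : Fin 1) :=
  (term_subst (Γ := Ctx.replicate 1 X) _ _ j).trans (Fin.sum_univ_one _)

theorem term_proj (Γ : Ctx (fpCocone C).Obj) (i j : Fin Γ.len) :
    term (proj Γ i) j = if h : i = j then eqToHom (congrArg Γ.fam h.symm) else 0 := by
  refine (term_act (Γ.pullHom (fun _ : Fin 1 => i)) _ j).trans ?_
  split_ifs with h
  · subst h
    refine (Finset.sum_eq_single ⟨(0 : Fin 1), rfl⟩ (fun k _ hk => absurd (Subtype.ext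
      (Subsingleton.elim (α := Fin 1) _ _)) hk) (fun h => absurd (Finset.mem_univ _) h)).trans ?_
    exact Category.comp_id _
  · exact Finset.sum_eq_zero fun k _ => absurd k.2 h

end

namespace CommMon

variable {C : CMonCat.{v, u}}

/-- The commutative monoid structure on an object `X` of `C▸` with multiplication `⟨1, 1⟩`. -/
def ofObj (X : (fpCocone C).Obj) : CommMon (fpCocone C) :=
  ofLaws X (ofTerms fun _ => 𝟙 X) (ofTerms fun i => i.elim0)
    (fun a b c => term_ext fun j => by
      simp only [term_op, term_ofTerms, Category.comp_id, _root_.add_assoc])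
    (fun a => term_ext fun j => by
      simp only [term_op, term_weaken, term_ofTerms, Category.comp_id, _root_.add_zero])
    (fun a b => term_ext fun j => by
      simp only [term_op, term_ofTerms, Category.comp_id, _root_.add_comm])

/-- A weakened nullary arrow has zero terms, so the laws `1 + 0 = 1` and `0 + 1 = 1`, read in the
single term of a unary arrow, isolate the two terms of the multiplication. Hence addition in any
commutative monoid of `C▸` is termwise. -/
theorem term_mul (A : CommMon (fpCocone C)) (i : Fin 2) : term A.mul i = 𝟙 A.X := by
  let a : (fpCocone C).Hom (Ctx.replicate 1 A.X) A.X := ofTerms fun _ => 𝟙 _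
  have z : term (A.zero (Ctx.replicate 1 A.X)) (0 : Fin 1) = 0 := term_weaken A.one _ _
  have h0 : term (op A.mul a (A.zero _)) (0 : Fin 1) = 𝟙 A.X :=
    congrArg (fun f => term f (0 : Fin 1)) (A.add_zero a)
  have h1 : term (op A.mul (A.zero _) a) (0 : Fin 1) = 𝟙 A.X :=
    congrArg (fun f => term f (0 : Fin 1)) (A.zero_add a)
  rw [term_op, z, CMonEnriched.zero_comp] at h0 h1
  rw [_root_.add_zero] at h0
  rw [_root_.zero_add] at h1
  exact Fin.cases ((Category.id_comp _).symm.trans h0)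
    (Fin.cases ((Category.id_comp _).symm.trans h1) fun i => i.elim0) i

theorem term_add (A : CommMon (fpCocone C)) {Θ : Ctx (fpCocone C).Obj}
    (a b : (fpCocone C).Hom Θ A.X) (j : Fin Θ.len) :
    term (A.add a b) j = term a j + term b j := by
  refine (term_op A.mul a b j).trans ?_
  rw [term_mul, term_mul, Category.comp_id, Category.comp_id]

theorem term_zero (A : CommMon (fpCocone C)) (Θ : Ctx (fpCocone C).Obj) (j : Fin Θ.len) :
    term (A.zero Θ) j = 0 :=
  term_weaken _ Θ j

/-- A term of a sequence of arrows, as an additive map. -/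
def termHom (A : CommMon (fpCocone C)) {Θ : Ctx (fpCocone C).Obj} (j : Fin Θ.len) :
    A.Elt Θ →+ (Θ.fam j ⟶ A.X) where
  toFun a := term (X := A.X) a j
  map_zero' := A.term_zero Θ j
  map_add' a b := A.term_add a b j

/-- A morphism of `C`, as a morphism of commutative monoids. -/
def ofHom {X Y : (fpCocone C).Obj} (f : X ⟶ Y) : ofObj X ⟶ ofObj Y :=
  Hom.ofApp (A := ofObj X) (B := ofObj Y) (ofTerms fun _ => f)
    (fun Θ a b => term_ext fun j => by
      rw [term_app, term_add, term_add, term_app, term_app]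
      exact CMonEnriched.add_comp _ _ _)
    (fun Θ => term_ext fun j => by
      rw [term_app, term_zero, term_zero]
      exact CMonEnriched.zero_comp _)

/-- The functor sending `X` to the commutative monoid `⟨1, 1⟩ : ⟨X, X⟩ → X` of `C▸`. -/
def unitFunctor (C : CMonCat.{v, u}) : C.carrier ⥤ CommMon (fpCocone C) where
  obj X := ofObj X
  map f := ofHom f
  map_id _ := Hom.ext rfl
  map_comp f g := Hom.ext (term_ext fun _ => (term_app (ofHom g).hom (ofHom f).hom _).symm)

theorem unitFunctor_map_add {X Y : C.carrier} (f g : X ⟶ Y) :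
    (unitFunctor C).map (f + g) = (unitFunctor C).map f + (unitFunctor C).map g :=
  Hom.ext (term_ext fun j => (term_add (ofObj Y) (ofHom f).hom (ofHom g).hom j).symm)

theorem unitFunctor_map_zero (X Y : C.carrier) :
    (unitFunctor C).map (0 : X ⟶ Y) = 0 :=
  Hom.ext (term_ext fun j => (term_zero (ofObj Y) _ j).symm)

/-- Taking the `j`-th term is additive, and the `j`-th term of the `i`-th projection is a Kronecker
delta. -/
theorem term_sum_app_proj (A : CommMon (fpCocone C)) {Γ : Ctx (fpCocone C).Obj}
    (g : ∀ i, (fpCocone C).Hom (Ctx.replicate 1 (Γ.fam i)) A.X) (j : Fin Γ.len) :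
    term (X := A.X) (Finset.univ.sum (M := A.Elt Γ) fun i => app (g i) (proj Γ i)) j =
      term (g j) (0 : Fin 1) := by
  let e : Fin Γ.len → A.Elt Γ := fun i => app (g i) (proj Γ i)
  refine (map_sum (termHom A j) e Finset.univ).trans ?_
  rw [Finset.sum_eq_single j]
  · refine (term_app (g j) (proj Γ j) j).trans ?_
    rw [term_proj, dif_pos rfl]
    exact Category.id_comp _
  · intro i _ hi
    refine (term_app (g i) (proj Γ i) j).trans ?_
    rw [term_proj, dif_neg hi]
    exact CMonEnriched.zero_comp _
  · exact fun h => absurd (Finset.mem_univ _) h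

/-- A sequence `⟨f₁, …, fₙ⟩` is the sum of the weakened arrows `fᵢ`. -/
theorem eq_sum_ofHom {Γ : Ctx (fpCocone C).Obj} {X : (fpCocone C).Obj}
    (f : (ofObj X).Elt Γ) :
    f = ∑ i, Hom.appHom (ofHom (term (X := X) f i)) Γ (proj Γ i) :=
  term_ext (X := X) fun j =>
    (term_sum_app_proj (ofObj X) (fun i => (ofHom (term (X := X) f i)).hom) j).symm

/-- An fp-functor defined on `C▸` is determined by its values on unary arrows. -/
theorem map_eq_sum {M : FpMlt.{v, u}} (F : fpCocone C ⟶ M) {Γ : Ctx (fpCocone C).Obj}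
    {X : (fpCocone C).Obj} (f : (ofObj X).Elt Γ) :
    mapHom F (ofObj X) Γ f = ∑ i, Hom.appHom (Hom.map F (ofHom (term (X := X) f i)))
      _ (proj (Γ.map (Functor.toFunctor F).obj) i) := by
  conv_lhs => rw [eq_sum_ofHom f, map_sum]
  refine Finset.sum_congr rfl fun i _ => ?_
  refine (map_subst F (Hom.hom (ofHom (term (X := X) f i))) (fun _ => proj Γ i)).trans ?_
  refine congrArg (subst _) (funext fun _ => ?_)
  -- Projections are weakened identities, hence preserved by any fp-functor.
  refine (FpMlt.Functor.map_act F _ _).trans ?_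
  exact congrArg (M.act _) (Mlt.Functor.map_id (Functor.toFunctor F) _)

end CommMon
end FpMlt

/-! ### The adjunction between `(-)▸` and `cMon(-)`. -/

namespace FpMlt
namespace CommMon

theorem liftMap_ofHom {C : CMonCat.{v, u}} {M : FpMlt.{v, u}} (F : C.carrier ⥤ CommMon M)
    {X Y : C.carrier} (f : X ⟶ Y) :
    liftMap F (Γ := Ctx.replicate 1 X) (fun _ => f) = (F.map f : Hom _ _).hom := by
  refine (Fin.sum_univ_one _).trans ?_
  refine Eq.trans (congrArg (app (Hom.hom (F.map f))) ?_) (app_id (Hom.hom (F.map f)))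
  refine Eq.trans ?_ (M.act_id _)
  exact congrArg (fun q => M.act q (M.id (F.obj X).X))
    (Ctx.Hom.ext (funext fun i : Fin 1 => Subsingleton.elim (α := Fin 1) _ _))

/-- On elements the image of `⟨1, 1⟩` is `h ↦ F(1) h₀ + F(1) h₁ = h₀ + h₁`, and the image of the
empty sequence is the empty sum. -/
theorem map_lift_ofObj {C : CMonCat.{v, u}} {M : FpMlt.{v, u}} (F : C.carrier ⥤ CommMon M)
    (hadd : ∀ {X Y : C.carrier} (f g : X ⟶ Y), F.map (f + g) = F.map f + F.map g)
    (hzero : ∀ X Y : C.carrier, F.map (0 : X ⟶ Y) = 0) (X : C.carrier) :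
    map (lift F hadd hzero) (ofObj X) = F.obj X := by
  refine ext' rfl (heq_of_eq ?_) (heq_of_eq ?_)
  · refine hom_ext fun {Θ} H => ?_
    refine (substHom_liftMap F (Γ := Ctx.replicate 2 X) (fun _ => 𝟙 X) H).trans ?_
    refine (Fin.sum_univ_two _).trans (Eq.trans ?_ (subst_mul (F.obj X) H).symm)
    exact congrArg₂ (F.obj X).add (appHom_id F X _) (appHom_id F X _)
  · refine hom_ext fun {Θ} H => ?_
    refine (substHom_liftMap F (Γ := Ctx.replicate 0 X) (fun i => i.elim0) H).trans ?_
    exact (Fin.sum_univ_zero _).trans (subst_one (F.obj X) H).symm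

/-- The additive functor from `C` to the commutative monoids of `M` that corresponds to an
fp-functor `C▸ ⟶ M`. -/
def transpose {C : CMonCat.{v, max u v}} {M : FpMlt.{v, max u v}} (F : fpCocone C ⟶ M) :
    C ⟶ cMon.{v, max u v}.obj M :=
  CategoryStruct.comp (obj := CMonCat.{v, max u v})
    (Y := cMon.{v, max u v}.obj (fpCocone C))
    (⟨unitFunctor C, unitFunctor_map_add, unitFunctor_map_zero⟩) (cMon.{v, max u v}.map F)

theorem cMonCat_hom_ext {C D : CMonCat.{v, u}} {F G : CMonCat.Functor C D}
    (hobj : ∀ X, F.obj X = G.obj X) (hmap : ∀ {X Y : C.carrier} (f : X ⟶ Y), F.map f ≍ G.map f) :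
    F = G := by
  obtain ⟨F, _, _⟩ := F
  obtain ⟨G, _, _⟩ := G
  obtain rfl : F = G := CategoryTheory.Functor.hext hobj fun _ _ f => hmap f
  rfl

/-- The adjunction between `(-)▸` and `cMon(-)`. -/
def adjunction : fpCoconeFunctor.{v, max u v} ⊣ cMon.{v, max u v} :=
  Adjunction.mkOfHomEquiv
    { homEquiv := fun C M =>
        { toFun := fun F => transpose F
          invFun := fun F => lift (CMonCat.Functor.toFunctor F) (CMonCat.Functor.map_add F)
            (CMonCat.Functor.map_zero F)
          left_inv := fun F => by
            refine FpMlt.Functor.ext rfl (heq_of_eq ?_)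
            funext Γ X f
            exact (map_eq_sum F f).symm
          -- The monoids recovered on objects equal the given ones only propositionally, so
          -- morphisms are compared by `HEq`.
          right_inv := fun F => cMonCat_hom_ext
            (fun X => map_lift_ofObj (CMonCat.Functor.toFunctor F) (CMonCat.Functor.map_add F)
              (CMonCat.Functor.map_zero F) X)
            (fun {X Y} f => Hom.hext
              (map_lift_ofObj (CMonCat.Functor.toFunctor F) (CMonCat.Functor.map_add F)
                (CMonCat.Functor.map_zero F) X)
              (map_lift_ofObj (CMonCat.Functor.toFunctor F) (CMonCat.Functor.map_add F)
                (CMonCat.Functor.map_zero F) Y)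
              (heq_of_eq (liftMap_ofHom (CMonCat.Functor.toFunctor F) f))) }
      homEquiv_naturality_left_symm := fun F G => rfl
      homEquiv_naturality_right := fun F G => rfl }

end CommMon

/-! ### Full faithfulness of `(-)▸`. -/

open CommMon in
/-- The additive functor `C ⟶ D` that induces a given fp-functor `C▸ ⟶ D▸`. -/
def unaryFunctor {C D : CMonCat.{v, u}} (F : fpCocone C ⟶ fpCocone D) : C ⟶ D where
  obj X := (Functor.toFunctor F).obj X
  map {X Y} f := term (Hom.hom (Hom.map F (ofHom f))) (0 : Fin 1)
  map_id X := congrArg (fun f => term f (0 : Fin 1))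
    (Mlt.Functor.map_id (Functor.toFunctor F) X)
  map_comp {X Y Z} f g := by
    refine Eq.trans ?_ (term_app (Hom.hom (Hom.map F (ofHom g)))
      (Hom.hom (Hom.map F (ofHom f))) (0 : Fin 1))
    refine congrArg (fun f => term f (0 : Fin 1)) (Eq.trans ?_
      (map_subst F (Hom.hom (ofHom g)) (fun _ => Hom.hom (ofHom f))))
    exact congrArg (fun f => (Functor.toFunctor F).map (Hom.hom f))
      ((unitFunctor C).map_comp f g)
  map_add {X Y} f g := by
    -- Sums are termwise in every commutative monoid of `D▸`, in particular in the image under `F`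
    -- of the canonical one.
    refine Eq.trans ?_ (term_add ((ofObj Y).map F) (Hom.hom (Hom.map F (ofHom f)))
      (Hom.hom (Hom.map F (ofHom g))) (0 : Fin 1))
    refine congrArg (fun f => term f (0 : Fin 1)) (Eq.trans ?_
      (CommMon.map_add F (ofObj Y) (Hom.hom (ofHom f)) (Hom.hom (ofHom g))))
    exact congrArg (fun f => (Functor.toFunctor F).map (Hom.hom f)) (unitFunctor_map_add f g)
  map_zero X Y := by
    refine Eq.trans ?_ (term_zero ((ofObj Y).map F) (Ctx.replicate 1 _) (0 : Fin 1))
    refine congrArg (fun f => term f (0 : Fin 1)) (Eq.trans ?_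
      (CommMon.map_zero F (ofObj Y) (Ctx.replicate 1 X)))
    exact congrArg (fun f => (Functor.toFunctor F).map (Hom.hom f)) (unitFunctor_map_zero X Y)

theorem unaryFunctor_fpCoconeFunctor_map {C D : CMonCat.{v, u}} (F : C ⟶ D) :
    unaryFunctor (fpCoconeFunctor.map F) = F :=
  rfl

/-- By `map_eq_sum` the value of `F` on a sequence is a sum of weakened unary values, and the `j`-th
term of that sum is the `j`-th unary value. -/
theorem fpCoconeFunctor_map_unaryFunctor {C D : CMonCat.{v, u}} (F : fpCocone C ⟶ fpCocone D) :
    fpCoconeFunctor.map (unaryFunctor F) = F := by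
  refine FpMlt.Functor.ext rfl (heq_of_eq ?_)
  funext Γ X f
  refine Eq.trans ?_ (CommMon.map_eq_sum F f).symm
  exact term_ext fun j => (CommMon.term_sum_app_proj ((CommMon.ofObj X).map F)
    (fun i => (CommMon.Hom.map F (CommMon.ofHom (term f i))).hom) j).symm

/-- The functor `(-)▸` is fully faithful. -/
def fullyFaithfulFpCoconeFunctor : fpCoconeFunctor.{v, u}.FullyFaithful where
  preimage := unaryFunctor
  map_preimage := fpCoconeFunctor_map_unaryFunctor
  preimage_map := unaryFunctor_fpCoconeFunctor_map

end FpMlt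

/-! ### Cartesian multicategories whose underlying multicategory is a discrete cocone one. -/

namespace Mlt

/-- The types of the arrow mappings depend on the object mappings, so the two composites are treated
as endofunctors equal to the identity, an equation that can be eliminated. -/
theorem map_bijective {M N : Mlt.{v, u}} (e : M ≅ N) (Γ : Ctx M.Obj) (X : M.Obj) :
    Function.Bijective (fun f : M.Hom Γ X => Functor.map e.hom f) := by
  have inj : ∀ {M : Mlt.{v, u}} (F : M ⟶ M), F = 𝟙 M → ∀ (Γ : Ctx M.Obj) (X : M.Obj),
      Function.Bijective (fun f : M.Hom Γ X => Functor.map F f) := by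
    rintro M _ rfl Γ X
    exact Function.bijective_id
  have h1 := inj _ e.hom_inv_id
  have h2 := inj _ e.inv_hom_id
  refine ⟨Function.Injective.of_comp (f := fun f => Functor.map e.inv f) (h1 Γ X).1, fun y => ?_⟩
  -- A preimage of `y` is found after applying the inverse, which is itself injective by `h2`.
  obtain ⟨x, hx⟩ := (h1 Γ X).2 (Functor.map e.inv y)
  exact ⟨x, Function.Injective.of_comp (f := fun f => Functor.map e.hom f) (h2 _ _).1 hx⟩

end Mlt

namespace FpMlt
variable {M : FpMlt.{v, u}}

theorem act_of_len_eq_zero {Γ Δ : Ctx M.Obj} {X : M.Obj} (p : Γ ⟶ Δ) (hΓ : Γ.len = 0)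
    (f : M.Hom Γ X) : M.act p f = subst f (fun i => (Fin.cast hΓ i).elim0) := by
  revert f hΓ
  refine Ctx.pullHom_induction (P := fun Γ p => ∀ (hΓ : Γ.len = 0) (f : M.Hom Γ X),
    M.act p f = subst f (fun i => (Fin.cast hΓ i).elim0)) (fun n q hΓ f => ?_) p
  refine (subst_proj _).symm.trans ((subst_act q f _).trans ?_)
  exact congrArg (subst f) (funext fun i => (Fin.cast hΓ i).elim0)

namespace Discrete

variable {C : Type u} [Category.{v} C] (e : M.toMlt ≅ cocone C)

/-- The object of `C` that corresponds to an object of `M`. -/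
def obj (X : M.Obj) : C := Mlt.Functor.obj e.hom X

/-- The terms of the sequence that corresponds to an arrow of `M`. -/
def term {Γ : Ctx M.Obj} {X : M.Obj} (f : M.Hom Γ X) (i : Fin Γ.len) :
    obj e (Γ.fam i) ⟶ obj e X :=
  Mlt.Functor.map e.hom f i

theorem term_bijective (Γ : Ctx M.Obj) (X : M.Obj) :
    Function.Bijective (fun f : M.Hom Γ X => term e f) :=
  Mlt.map_bijective e Γ X

theorem term_id (X : M.Obj) (i : Fin 1) : term e (M.id X) i = 𝟙 (obj e X) :=
  congrFun (Mlt.Functor.map_id e.hom X) i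

theorem term_comp {Γ : Ctx M.Obj} {X : M.Obj} (f : M.Hom Γ X) {Δ : Fin Γ.len → Ctx M.Obj}
    (g : ∀ i, M.Hom (Δ i) (Γ.fam i)) (s : Fin (∑ i, (Δ i).len)) :
    term e (M.comp f g) s =
      term e (g (finSigmaFinEquiv.symm s).1) (finSigmaFinEquiv.symm s).2 ≫
        term e f (finSigmaFinEquiv.symm s).1 :=
  congrFun (Mlt.Functor.map_comp e.hom f g) s

theorem eq_of_len_eq_zero (e : M.toMlt ≅ cocone C) {Γ : Ctx M.Obj} (hΓ : Γ.len = 0) {X : M.Obj} (f g : M.Hom Γ X) :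
    f = g :=
  (term_bijective e Γ X).1 (funext fun i => (Fin.cast hΓ i).elim0)

/-- The unique arrow `⟨⟩ → X`. -/
noncomputable def null (X : M.Obj) : M.Hom (Ctx.replicate 0 X) X :=
  ((term_bijective e (Ctx.replicate 0 X) X).2 fun i => Fin.elim0 i).choose

/-- The zero arrow `Θ → X`. -/
noncomputable def zero (Θ : Ctx M.Obj) (X : M.Obj) : M.Hom Θ X :=
  weaken (null e X) Θ

theorem zero_subst {Θ Ξ : Ctx M.Obj} {X : M.Obj} (g : ∀ i, M.Hom Ξ (Θ.fam i)) :
    subst (zero e Θ X) g = zero e Ξ X :=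
  weaken_subst _ g

/-- Zeros are weakened from the empty sequence, where uniqueness of the arrow `⟨⟩ → X` gives `f(0,
…, 0) = 0`. -/
theorem subst_zero {Γ : Ctx M.Obj} {X : M.Obj} (f : M.Hom Γ X) (Θ : Ctx M.Obj) :
    subst f (fun i => zero e Θ (Γ.fam i)) = zero e Θ X := by
  have h : subst f (fun i => zero e (Ctx.replicate 0 X) (Γ.fam i)) = null e X :=
    eq_of_len_eq_zero e rfl _ _
  refine Eq.trans ?_ (congrArg (fun f => weaken f Θ) h)
  refine Eq.trans ?_ (subst_subst _ _ _).symm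
  exact congrArg (subst f) (funext fun i => (zero_subst e _).symm)

/-- The arrow `Xᵢ → Xⱼ` that is the identity if `i = j` and zero otherwise. -/
noncomputable def incl (Γ : Ctx M.Obj) (i j : Fin Γ.len) :
    M.Hom (Ctx.replicate 1 (Γ.fam i)) (Γ.fam j) :=
  if h : i = j then
    Eq.rec (motive := fun j _ => M.Hom (Ctx.replicate 1 (Γ.fam i)) (Γ.fam j)) (M.id (Γ.fam i)) h
  else zero e _ _

theorem incl_self (Γ : Ctx M.Obj) (i : Fin Γ.len) : incl e Γ i i = M.id (Γ.fam i) :=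
  dif_pos rfl

theorem incl_of_ne {Γ : Ctx M.Obj} {i j : Fin Γ.len} (h : i ≠ j) : incl e Γ i j = zero e _ _ :=
  dif_neg h

/-- The restriction of an arrow to its `i`-th argument, with zeros at the other ones. -/
noncomputable def restrict {Γ : Ctx M.Obj} {X : M.Obj} (f : M.Hom Γ X) (i : Fin Γ.len) :
    M.Hom (Ctx.replicate 1 (Γ.fam i)) X :=
  subst f (incl e Γ i)

/-- The identity needs one place and the zero arrow none. The arrow before weakening is kept because
`e` computes terms of composites but says nothing about the action. -/
theorem exists_incl_eq_act (Γ : Ctx M.Obj) (i j : Fin Γ.len) {k : ℕ} (h1 : i = j → k = 1)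
    (h0 : i ≠ j → k = 0) : ∃ g : M.Hom (Ctx.replicate k (Γ.fam i)) (Γ.fam j),
      incl e Γ i j = M.act (Δ := Ctx.replicate 1 (Γ.fam i)) ⟨fun _ => (0 : Fin 1), fun _ => rfl⟩ g ∧
      ∀ (s : Fin k) (h : i = j),
        term e g s = eqToHom (congrArg (fun j => obj e (Γ.fam j)) h) := by
  by_cases h : i = j
  · obtain rfl := h1 h
    subst h
    refine ⟨M.id _, ?_, fun s _ => term_id e _ s⟩
    refine (incl_self e Γ i).trans ((M.act_id _).symm.trans ?_)
    exact congrArg (fun q => M.act q (M.id (Γ.fam i)))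
      (Ctx.Hom.ext (funext fun _ => Subsingleton.elim (α := Fin 1) _ _))
  · obtain rfl := h0 h
    refine ⟨zero e _ _, ?_, fun _ h' => absurd h' h⟩
    rw [incl_of_ne e h, act_of_len_eq_zero _ rfl]
    exact (zero_subst e _).symm

/-- A one-element index set has only the identity mapping, so the action is known here although `e`
need not respect it. -/
theorem term_act_of_len_eq_one {n : ℕ} {X Y : M.Obj} (hn : n = 1)
    (p : Ctx.replicate n Y ⟶ Ctx.replicate 1 Y) (f : M.Hom (Ctx.replicate n Y) X) (s : Fin n) :
    term e (M.act p f) (0 : Fin 1) = term e f s := by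
  subst hn
  obtain rfl : p = 𝟙 _ := Ctx.Hom.ext (funext fun _ => Subsingleton.elim (α := Fin 1) _ _)
  obtain rfl : s = 0 := Subsingleton.elim _ _
  rw [M.act_id]

/-- This links the fp-structure to the terms. All weakenings in `f(0, …, 1, …, 0)` are pulled out by
`comp_act`; the composite left inside has a domain of total length one, so the action on it is
trivial and composition in `C▸` gives its only term. -/
theorem term_restrict {Γ : Ctx M.Obj} {X : M.Obj} (f : M.Hom Γ X) (i : Fin Γ.len) :
    term e (restrict e f i) (0 : Fin 1) = term e f i := by
  let k : Fin Γ.len → ℕ := fun j => if i = j then 1 else 0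
  choose g hg ht using fun j => exists_incl_eq_act e Γ i j (k := k j) (fun h => if_pos h)
    (fun h => if_neg h)
  have hr : restrict e f i = M.act (Ctx.foldHom Γ.len _) (M.act
      (Ctx.sumHom (Δ' := fun _ => Ctx.replicate 1 (Γ.fam i))
        fun _ => ⟨fun _ => (0 : Fin 1), fun _ => rfl⟩)
      (M.comp f (Δ := fun j => Ctx.replicate (k j) (Γ.fam i)) g)) := by
    rw [← M.comp_act, restrict, funext hg]
    rfl
  rw [hr, ← M.act_act]
  -- Blocks with `j ≠ i` are empty, so every position lies in block `i`.
  have hz : ∀ z : Σ j, Fin (k j), term e (g z.1) z.2 ≫ term e f z.1 = term e f i := by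
    rintro ⟨j, s⟩
    have h : i = j := by
      by_contra h
      have : k j = 0 := if_neg h
      exact (Fin.cast this s).elim0
    subst h
    rw [ht i s rfl]
    exact Category.id_comp _
  have hk : ∑ j, k j = 1 := by simp [k]
  -- The concatenated domain is definitionally a constant sequence, of length `∑ j, k j = 1`.
  exact (term_act_of_len_eq_one e hk _ _ (Fin.cast hk.symm 0)).trans
    ((term_comp e f g _).trans (hz _))

theorem ext_restrict {Γ : Ctx M.Obj} {X : M.Obj} {f g : M.Hom Γ X}
    (h : ∀ i, restrict e f i = restrict e g i) : f = g :=
  (term_bijective e Γ X).1 (funext fun i => by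
    refine (term_restrict e f i).symm.trans (Eq.trans ?_ (term_restrict e g i))
    rw [h i])

theorem exists_restrict_eq {Γ : Ctx M.Obj} {X : M.Obj}
    (r : ∀ i, M.Hom (Ctx.replicate 1 (Γ.fam i)) X) : ∃ f : M.Hom Γ X, ∀ i, restrict e f i = r i := by
  obtain ⟨f, hf⟩ := (term_bijective e Γ X).2 fun i => term e (r i) (0 : Fin 1)
  refine ⟨f, fun i => (term_bijective e _ _).1 (funext fun s => ?_)⟩
  obtain rfl : s = (0 : Fin 1) := Subsingleton.elim (α := Fin 1) _ _
  exact (term_restrict e f i).trans (congrFun hf i)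

/-- The arrow `⟨X, X⟩ → X` whose restrictions are identities. -/
noncomputable def mul (X : M.Obj) : M.Hom (Ctx.replicate 2 X) X :=
  (exists_restrict_eq e (Γ := Ctx.replicate 2 X) fun _ => M.id X).choose

theorem restrict_mul (X : M.Obj) (i : Fin 2) : restrict e (mul e X) i = M.id X :=
  (exists_restrict_eq e (Γ := Ctx.replicate 2 X) fun _ => M.id X).choose_spec i

theorem subst_incl_app {Γ Θ : Ctx M.Obj} {X : M.Obj} (f : M.Hom Γ X) (i : Fin Γ.len)
    (a : M.Hom Θ (Γ.fam i)) : subst f (fun j => app (incl e Γ i j) a) = app (restrict e f i) a :=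
  (subst_subst _ _ _).symm

/-- The pair `(a, 0)` is the first inclusion composed with `a`, and the restriction of the
multiplication along it is the identity. -/
theorem op_zero {Θ : Ctx M.Obj} {X : M.Obj} (a : M.Hom Θ X) :
    op (mul e X) a (zero e Θ X) = a := by
  refine Eq.trans ?_ (((subst_incl_app e (mul e X) (0 : Fin 2) a).trans
    (congrArg (fun f => app f a) (restrict_mul e X 0))).trans (id_app a))
  refine Eq.trans ?_ (subst_two _ _).symm
  rw [incl_self e (Ctx.replicate 2 X) (0 : Fin 2),
    incl_of_ne e (Γ := Ctx.replicate 2 X) (i := (0 : Fin 2)) (j := (1 : Fin 2)) (show (0 : Fin 2) ≠ 1 by decide)]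
  exact congrArg₂ (op (mul e X)) (id_app a).symm (zero_subst e _).symm

theorem zero_op {Θ : Ctx M.Obj} {X : M.Obj} (a : M.Hom Θ X) :
    op (mul e X) (zero e Θ X) a = a := by
  refine Eq.trans ?_ (((subst_incl_app e (mul e X) (1 : Fin 2) a).trans
    (congrArg (fun f => app f a) (restrict_mul e X 1))).trans (id_app a))
  refine Eq.trans ?_ (subst_two _ _).symm
  rw [incl_self e (Ctx.replicate 2 X) (1 : Fin 2),
    incl_of_ne e (Γ := Ctx.replicate 2 X) (i := (1 : Fin 2)) (j := (0 : Fin 2)) (show (1 : Fin 2) ≠ 0 by decide)]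
  exact congrArg₂ (op (mul e X)) (zero_subst e _).symm (id_app a).symm

theorem incl_replicate {n : ℕ} (X : M.Obj) (i j : Fin n) :
    incl e (Ctx.replicate n X) i j = if i = j then M.id X else zero e _ X := by
  split_ifs with h
  · subst h
    exact incl_self e (Ctx.replicate n X) i
  · exact incl_of_ne e (Γ := Ctx.replicate n X) h

theorem proj_incl {n : ℕ} (X : M.Obj) (i j : Fin n) :
    subst (proj (Ctx.replicate n X) j) (incl e (Ctx.replicate n X) i) =
      if i = j then M.id X else zero e _ X :=
  (subst_proj_apply (Γ := Ctx.replicate n X) j _).trans (incl_replicate e X i j)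

/-- Two arrows `⟨X, …, X⟩ → Y` agree when they do so on identities and zeros. -/
theorem ext_replicate {n : ℕ} {X Y : M.Obj} {f g : M.Hom (Ctx.replicate n X) Y}
    (h : ∀ i : Fin n, restrict e f i = restrict e g i) {Θ : Ctx M.Obj} (a : Fin n → M.Hom Θ X) :
    subst f a = subst g a := by
  obtain rfl : f = g := ext_restrict e h
  rfl

/-- It suffices to treat the generic pair of projections. Both sides are then arrows `⟨X, X⟩ → X`,
determined by their restrictions; associativity and `app_op` use the same method. -/
theorem op_comm {Θ : Ctx M.Obj} {X : M.Obj} (a b : M.Hom Θ X) :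
    op (mul e X) a b = op (mul e X) b a := by
  let p : Fin 2 → M.Hom (Ctx.replicate 2 X) X := proj (Ctx.replicate 2 X)
  have key := ext_replicate e (f := op (mul e X) (p 0) (p 1)) (g := op (mul e X) (p 1) (p 0))
    (fun i => by
      simp only [p, restrict, op_subst, proj_incl]
      -- Restriction replaces one projection by the identity and the other by zero, so only unit
      -- laws are left.
      fin_cases i <;> simp [op_zero, zero_op]) ![a, b]
  have hp : ∀ j : Fin 2, subst (p j) (fun j : Fin 2 => ![a, b] j) = ![a, b] j := fun j =>
    subst_proj_apply (Γ := Ctx.replicate 2 X) j _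
  rw [op_subst, op_subst] at key
  exact (congrArg₂ (op (mul e X)) (hp 0) (hp 1)).symm.trans
    (key.trans (congrArg₂ (op (mul e X)) (hp 1) (hp 0)))

theorem op_assoc {Θ : Ctx M.Obj} {X : M.Obj} (a b c : M.Hom Θ X) :
    op (mul e X) (op (mul e X) a b) c = op (mul e X) a (op (mul e X) b c) := by
  let p : Fin 3 → M.Hom (Ctx.replicate 3 X) X := proj (Ctx.replicate 3 X)
  have key := ext_replicate e (f := op (mul e X) (op (mul e X) (p 0) (p 1)) (p 2))
    (g := op (mul e X) (p 0) (op (mul e X) (p 1) (p 2)))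
    (fun i => by
      simp only [p, restrict, op_subst, proj_incl]
      fin_cases i <;> simp [op_zero, zero_op]) ![a, b, c]
  have hp : ∀ j : Fin 3, subst (p j) (fun j : Fin 3 => ![a, b, c] j) = ![a, b, c] j := fun j =>
    subst_proj_apply (Γ := Ctx.replicate 3 X) j _
  rw [op_subst, op_subst, op_subst, op_subst] at key
  exact (congrArg₂ (op (mul e X)) (congrArg₂ (op (mul e X)) (hp 0) (hp 1)) (hp 2)).symm.trans
    (key.trans (congrArg₂ (op (mul e X)) (hp 0) (congrArg₂ (op (mul e X)) (hp 1) (hp 2))))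

theorem app_zero {X Y : M.Obj} (f : M.Hom (Ctx.replicate 1 X) Y) (Θ : Ctx M.Obj) :
    app f (zero e Θ X) = zero e Θ Y :=
  subst_zero e f Θ

theorem app_subst {X Y : M.Obj} (f : M.Hom (Ctx.replicate 1 X) Y) {Θ Ξ : Ctx M.Obj}
    (a : M.Hom Θ X) (g : ∀ i, M.Hom Ξ (Θ.fam i)) : subst (app f a) g = app f (subst a g) :=
  subst_subst _ _ _

/-- On restrictions this reduces to `f(1 + 0) = f(1) + f(0)` and its mirror image. It is why no
unary arrow is lost on passing to commutative monoids. -/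
theorem app_op {X Y : M.Obj} (f : M.Hom (Ctx.replicate 1 X) Y) {Θ : Ctx M.Obj}
    (a b : M.Hom Θ X) : app f (op (mul e X) a b) = op (mul e Y) (app f a) (app f b) := by
  let p : Fin 2 → M.Hom (Ctx.replicate 2 X) X := proj (Ctx.replicate 2 X)
  have key := ext_replicate e (f := app f (op (mul e X) (p 0) (p 1)))
    (g := op (mul e Y) (app f (p 0)) (app f (p 1)))
    (fun i => by
      simp only [p, restrict, op_subst, app_subst, proj_incl]
      fin_cases i <;> simp [op_zero, zero_op, app_zero]) ![a, b]
  have hp : ∀ j : Fin 2, subst (p j) (fun j : Fin 2 => ![a, b] j) = ![a, b] j := fun j =>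
    subst_proj_apply (Γ := Ctx.replicate 2 X) j _
  rw [app_subst, op_subst, op_subst, app_subst, app_subst] at key
  exact (congrArg (app f) (congrArg₂ (op (mul e X)) (hp 0) (hp 1))).symm.trans
    (key.trans (congrArg₂ (op (mul e Y)) (congrArg (app f) (hp 0)) (congrArg (app f) (hp 1))))

/-- The commutative monoid structure on an object. -/
noncomputable def commMon (X : M.Obj) : CommMon M :=
  CommMon.ofLaws X (mul e X) (null e X) (op_assoc e) (op_zero e) (op_comm e)

/-- Every unary arrow is a morphism of commutative monoids. -/
noncomputable def ofUnary {X Y : M.Obj} (f : M.Hom (Ctx.replicate 1 X) Y) :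
    commMon e X ⟶ commMon e Y :=
  CommMon.Hom.ofApp (A := commMon e X) (B := commMon e Y) f (fun _ a b => app_op e f a b)
    (fun Θ => app_zero e f Θ)

/-- The objects of `M`, as objects of the category of unary arrows. -/
def Unary (_ : M.toMlt ≅ cocone C) : Type u := M.Obj

/-- The category of unary arrows of `M`. -/
noncomputable instance : Category.{v} (Unary e) where
  Hom X Y := commMon e X ⟶ commMon e Y
  id X := 𝟙 (commMon e X)
  comp f g := CategoryStruct.comp (obj := CommMon M) f g
  id_comp f := Category.id_comp (obj := CommMon M) f
  comp_id f := Category.comp_id (obj := CommMon M) f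
  assoc f g h := Category.assoc (obj := CommMon M) f g h

noncomputable instance : CMonEnriched (Unary e) where
  addCommMonoid X Y := inferInstanceAs (AddCommMonoid (commMon e X ⟶ commMon e Y))
  add_comp f g h := CMonEnriched.add_comp (C := CommMon M) f g h
  comp_add f g h := CMonEnriched.comp_add (C := CommMon M) f g h
  zero_comp h := CMonEnriched.zero_comp (C := CommMon M) h
  comp_zero h := CMonEnriched.comp_zero (C := CommMon M) h

/-- The preadditive category of unary arrows of `M`. -/
noncomputable def unaryCat : CMonCat.{v, u} := ⟨Unary e⟩

/-- The inclusion of the category of unary arrows in the category of commutative monoids. -/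
noncomputable def toCommMon : (unaryCat e).carrier ⥤ CommMon M where
  obj X := commMon e X
  map f := f
  map_id _ := rfl
  map_comp _ _ := rfl

/-- The fp-functor from the cocones of the category of unary arrows to `M`. -/
noncomputable def ofCocone : fpCocone (unaryCat e) ⟶ M :=
  CommMon.lift (toCommMon e) (fun _ _ => rfl) (fun _ _ => rfl)

/-- Substituting the inclusion at `i` kills every summand but the `i`-th. So lifting and restricting
are mutually inverse on arrows. -/
theorem restrict_liftMap {Γ : Ctx (unaryCat e).carrier} {X : (unaryCat e).carrier}
    (f : ∀ i, Γ.fam i ⟶ X) (i : Fin Γ.len) :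
    restrict e (Γ := Γ) (X := X) (CommMon.liftMap (toCommMon e) f) i =
      CommMon.Hom.hom ((toCommMon e).map (f i)) := by
  refine (CommMon.substHom_liftMap (toCommMon e) f (incl e Γ i)).trans ?_
  refine (Finset.sum_eq_single i (fun j _ hj => ?_) (fun h => absurd (Finset.mem_univ _) h)).trans ?_
  · exact (congrArg (CommMon.Hom.appHom ((toCommMon e).map (f j)) _)
      (incl_of_ne e (Γ := Γ) (Ne.symm hj))).trans (app_zero e _ _)
  · exact (congrArg (CommMon.Hom.appHom ((toCommMon e).map (f i)) _)
      (incl_self e Γ i)).trans (app_id _)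

theorem ofCocone_map_injective {Γ : Ctx (fpCocone (unaryCat e)).Obj}
    {X : (fpCocone (unaryCat e)).Obj} :
    Function.Injective fun f : (fpCocone (unaryCat e)).Hom Γ X =>
      (Functor.toFunctor (ofCocone e)).map f := by
  intro f g h
  refine funext fun i => CommMon.Hom.ext ?_
  have h' : CommMon.liftMap (toCommMon e) f = CommMon.liftMap (toCommMon e) g := h
  exact (restrict_liftMap e (Γ := Γ) (X := X) f i).symm.trans
    ((congrArg (fun f => restrict e (Γ := Γ) (X := X) f i) h').trans
      (restrict_liftMap e (Γ := Γ) (X := X) g i))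

/-- The sequence of the restrictions of an arrow. -/
noncomputable def restrictions {Γ : Ctx M.Obj} {X : M.Obj} (f : M.Hom Γ X) :
    (fpCocone (unaryCat e)).Hom Γ X :=
  fun i => ofUnary e (restrict e f i)

theorem ofCocone_map_restrictions {Γ : Ctx M.Obj} {X : M.Obj} (f : M.Hom Γ X) :
    (Functor.toFunctor (ofCocone e)).map (restrictions e f) = f :=
  ext_restrict e fun i => restrict_liftMap e (Γ := Γ) (X := X) (restrictions e f) i

/-- The inverse of `ofCocone`. -/
noncomputable def toCocone : M ⟶ fpCocone (unaryCat e) where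
  obj X := X
  map f := restrictions e f
  -- Each law is checked after applying `ofCocone`, which is injective on arrows and already
  -- satisfies it.
  map_id X := ofCocone_map_injective e ((ofCocone_map_restrictions e _).trans
    (Mlt.Functor.map_id (Functor.toFunctor (ofCocone e)) X).symm)
  map_comp f Δ g := ofCocone_map_injective e (by
    refine (ofCocone_map_restrictions e _).trans (Eq.trans ?_
      (Mlt.Functor.map_comp (Functor.toFunctor (ofCocone e)) _ _).symm)
    exact (congr (congrArg (fun f g => M.comp f g) (ofCocone_map_restrictions e f))
      (funext fun i => ofCocone_map_restrictions e (g i))).symm)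
  map_act p f := ofCocone_map_injective e (by
    refine (ofCocone_map_restrictions e _).trans (Eq.trans ?_
      (Functor.map_act (ofCocone e) _ _).symm)
    exact congrArg (M.act p) (ofCocone_map_restrictions e f).symm)

/-- A cartesian multicategory whose underlying multicategory is a discrete cocone multicategory
is isomorphic to the one of the category of its unary arrows. -/
noncomputable def isoCocone : fpCocone (unaryCat e) ≅ M where
  hom := ofCocone e
  inv := toCocone e
  hom_inv_id := FpMlt.Functor.ext rfl (heq_of_eq (by
    funext Γ X f
    exact ofCocone_map_injective e (ofCocone_map_restrictions e _)))
  inv_hom_id := FpMlt.Functor.ext rfl (heq_of_eq (by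
    funext Γ X f
    exact ofCocone_map_restrictions e f))

end Discrete

/-! ### The equivalence and the coreflection. -/

/-- Membership in the subcategory concerns only the underlying multicategory; `Discrete.isoCocone`
supplies an isomorphism that also respects the fp-structure. -/
instance : toCocones.{v, u}.IsEquivalence where
  faithful := ⟨fun {_ _} F G h => fullyFaithfulFpCoconeFunctor.map_injective
    (congrArg (fun F => isCocone.ι.map F) h)⟩
  full := ⟨fun {_ _} F => ⟨fullyFaithfulFpCoconeFunctor.preimage (isCocone.ι.map F),
    isCocone.ι.map_injective (fullyFaithfulFpCoconeFunctor.map_preimage _)⟩⟩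
  essSurj := ⟨fun M => by
    obtain ⟨C, _, ⟨e⟩⟩ := M.property
    exact ⟨Discrete.unaryCat e, ⟨isCocone.isoMk (Discrete.isoCocone e)⟩⟩⟩

/-- The functor `M ↦ cMon(M)▸` is right adjoint to the inclusion. -/
noncomputable def inclusionAdjunction :
    isCocone.{v, max u v}.ι ⊣ cMon.{v, max u v} ⋙ toCocones.{v, max u v} :=
  -- The inverse equivalence is left adjoint to `toCocones`; following it by `(-)▸` gives a functor
  -- isomorphic to the inclusion through the counit.
  (toCocones.{v, max u v}.asEquivalence.symm.toAdjunction.comp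
    CommMon.adjunction.{v, u}).ofNatIsoLeft
      (Functor.isoWhiskerRight toCocones.{v, max u v}.asEquivalence.counitIso isCocone.ι ≪≫
        Functor.leftUnitor _)

end FpMlt

/-- A commutative monoid in `M` includes arrows among its data, so the objects of `cMon` live in
`max u v`; hence the universe levels in the last two claims. -/
theorem mainTheorem11 :
    FpMlt.toCocones.{v, u}.IsEquivalence ∧
      Nonempty (Coreflective FpMlt.isCocone.{v, max u v}.ι) ∧
      Nonempty (FpMlt.isCocone.{v, max u v}.ι ⊣
        FpMlt.cMon.{v, max u v} ⋙ FpMlt.toCocones.{v, max u v}) :=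
  ⟨inferInstance, ⟨{ R := _, adj := FpMlt.inclusionAdjunction }⟩, ⟨FpMlt.inclusionAdjunction⟩⟩
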